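/- Let $\mathcal M$ be a separable $\mathrm{II}_1$ factor (a $\mathrm{II}_1$ factor acting on a separable Hilbert space) with faithful normal tracial state $\tau$ and two-norm $\|x\|_2=\tau(x^*x)^{1/2}$. Let $A\subset\mathcal M$ be a maximal abelian self-adjoint subalgebra (masa) that is singular, i.e. every unitary $u\in\mathcal M$ with $uAu^*=A$ belongs to $A$, and let $\mathbb E_A:\mathcal M\to A$ be the $\tau$-preserving conditional expectation. Let $v$ be a Haar unitary generator of $A$: a unitary $v\in A$ with $\tau(v^k)=0$ for all $k\in\mathbb Z\setminus\{0\}$ that generates $A$ as a von Neumann algebra. Then: (i) for every finite family $x_1,\dots,x_n\in\mathcal M$ with $\mathbb E_A(x_i)=0$ for all $i$, $$\frac1{2N+1}\sum_{k=-N}^{N}\Big(\sum_{i=1}^n\big\|\mathbb E_A(x_iv^kx_i^*)\big\|_2^2\Big)\longrightarrow 0\quad\text{as }N\to\infty;$$ (ii) the unitary in the weak asymptotic homomorphism property of $A$ can be chosen to be a power $v^k$ with $k$ arbitrarily large: for every $\varepsilon>0$, every finite family $x_1,\dots,x_n\in\mathcal M$ and every $K\in\mathbb N$ there is an integer $k\ge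 K$ such that $$\big\|\mathbb E_A(x_iv^kx_j^*)-\mathbb E_A(x_i)\,v^k\,\mathbb E_A(x_j^*)\big\|_2<\varepsilon\quad\text{for all }1\le i,j\le n.$$ -/

import Mathlib

namespace MasaWAHP

section Algebra

variable {R : Type*} [Ring R] [StarRing R] [Algebra ℂ R] [StarModule ℂ R]

/-- The two-norm `‖x‖₂ = τ(x* x)^{1/2}` attached to a positive functional `τ`. -/
noncomputable def twoNorm (τ : R →ₗ[ℂ] ℂ) (x : R) : ℝ :=
  Real.sqrt (τ (star x * x)).re

/-- `A` is a masa of `R`: maximal among the abelian (unital) self-adjoint subalgebras of `R`. -/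
def IsMasa (A : StarSubalgebra ℂ R) : Prop :=
  Maximal (fun B : StarSubalgebra ℂ R => ∀ x ∈ B, ∀ y ∈ B, x * y = y * x) A

/-- The normalizing unitaries of `A`: the unitaries `u` of `R` with `u A u* = A`. -/
def normalizingUnitaries (A : StarSubalgebra ℂ R) : Set R :=
  {u | u ∈ unitary R ∧ (fun a => u * a * star u) '' (A : Set R) = A}

/-- `A` is singular: every normalizing unitary of `A` lies in `A`. -/
def IsSingular (A : StarSubalgebra ℂ R) : Prop :=
  normalizingUnitaries A ⊆ A

/-- `a` is the orthogonal projection of `x` to `A` for the inner product `⟨x, b⟩ = τ(b* x)`: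
`a` belongs to `A` and `x - a` is orthogonal to `A`. -/
def IsProjTo (τ : R →ₗ[ℂ] ℂ) (A : StarSubalgebra ℂ R) (x a : R) : Prop :=
  a ∈ A ∧ ∀ b ∈ A, τ (star b * (x - a)) = 0

/-- If `τ` is faithful, then the projection of `x` to `A` is unique. -/
theorem IsProjTo.unique {τ : R →ₗ[ℂ] ℂ} (hτ : ∀ x, τ (star x * x) = 0 → x = 0)
    {A : StarSubalgebra ℂ R} {x a a' : R} (h : IsProjTo τ A x a) (h' : IsProjTo τ A x a') :
    a = a' := by
  have hm : a - a' ∈ A := sub_mem h.1 h'.1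
  have e : a - a' = (x - a') - (x - a) := by abel
  refine sub_eq_zero.1 (hτ _ ?_)
  conv_lhs => rw [show star (a - a') * (a - a')
    = star (a - a') * (x - a') - star (a - a') * (x - a) by rw [← mul_sub, ← e]]
  rw [map_sub, h.2 _ hm, h'.2 _ hm, sub_zero]

open Classical in
/-- The trace preserving conditional expectation `E_A` onto `A`: the restriction to `R` of the
orthogonal projection of `L²(R, τ)` onto the closure of `A`. So `E_A x` is the element of `A` with
`τ(b* E_A(x)) = τ(b* x)` for all `b` in `A`. For a von Neumann subalgebra `A` of a von Neumann
algebra with faithful normal tracial state `τ` it exists (and is unique) for every `x`; the value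
`0` in the other case is never used. -/
noncomputable def condExp (τ : R →ₗ[ℂ] ℂ) (A : StarSubalgebra ℂ R) (x : R) : R :=
  if h : ∃ a, IsProjTo τ A x a then h.choose else 0

end Algebra

section VonNeumann

variable {H : Type*} [NormedAddCommGroup H] [InnerProductSpace ℂ H] [CompleteSpace H]

/-- `M` is a factor of type `II₁`: the centre is trivial, the unit is a finite projection (every
isometry in `M` is unitary), and there is no minimal projection. -/
structure IsTypeIIOneFactor (M : VonNeumannAlgebra H) : Prop where
  one_ne_zero : (1 : M.toStarSubalgebra) ≠ 0
  center : ∀ z : M.toStarSubalgebra, (∀ x, z * x = x * z) → ∃ c : ℂ, z = c • 1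
  finite : ∀ w : M.toStarSubalgebra, star w * w = 1 → w * star w = 1
  no_minimal : ∀ p : M.toStarSubalgebra, IsStarProjection p → p ≠ 0 →
    ∃ q : M.toStarSubalgebra, IsStarProjection q ∧ q * p = q ∧ q ≠ 0 ∧ q ≠ p

/-- `τ` is a faithful normal tracial state on `M`. Normality is `σ`-weak continuity: `τ` is of the
form `x ↦ ∑ ⟨x ξₘ, ξₘ⟩` with `∑ ‖ξₘ‖² < ∞`. -/
structure IsFaithfulNormalTracialState (M : VonNeumannAlgebra H)
    (τ : M.toStarSubalgebra →ₗ[ℂ] ℂ) : Prop where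
  map_one : τ 1 = 1
  nonneg : ∀ x, 0 ≤ (τ (star x * x)).re ∧ (τ (star x * x)).im = 0
  faithful : ∀ x, τ (star x * x) = 0 → x = 0
  tracial : ∀ x y, τ (x * y) = τ (y * x)
  normal : ∃ ξ : ℕ → H, (Summable fun m => ‖ξ m‖ ^ 2) ∧
    ∀ x : M.toStarSubalgebra, HasSum (fun m => inner ℂ (ξ m) ((x : H →L[ℂ] H) (ξ m))) (τ x)

/-- `v` is a Haar unitary generator of `A`: a unitary in `A` with `τ(v ^ k) = 0` for every nonzero
integer `k`, such that the von Neumann algebra `{v, v*}''` generated by `v` is `A`. -/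
structure IsHaarUnitaryGenerator (M : VonNeumannAlgebra H) (τ : M.toStarSubalgebra →ₗ[ℂ] ℂ)
    (A : StarSubalgebra ℂ M.toStarSubalgebra) (v : unitary M.toStarSubalgebra) : Prop where
  mem : (v : M.toStarSubalgebra) ∈ A
  trace_zpow : ∀ k : ℤ, k ≠ 0 → τ ((v ^ k : unitary M.toStarSubalgebra) : M.toStarSubalgebra) = 0
  generates : (Subtype.val '' (A : Set M.toStarSubalgebra) : Set (H →L[ℂ] H)) =
    Set.centralizer (Set.centralizer
      {((v : M.toStarSubalgebra) : H →L[ℂ] H), star ((v : M.toStarSubalgebra) : H →L[ℂ] H)})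

end VonNeumann

end MasaWAHP

/-!
Let `A = {v}''` be a singular masa of the finite von Neumann algebra `M`, and suppose that
`E_A(x) = 0` but that the averages of `‖E_A(x v^k x*)‖₂²` do not tend to `0`.

**A lower bound over partitions.** Let `e_A` be the projection of `L²(M)` onto the closure of `A`.
A weak limit `T` of the averages of `v^k x* e_A x v^{-k}` commutes with `v`, hence with `A`, and
`⟨T x*, x*⟩ > 0`. Splitting `x*` along a partition `(rᵢ)` of the unit in `A` and estimating each
piece by the Cauchy-Schwarz inequality for `E_A` gives a constant `c > 0` with
`c ≤ ∑ᵢ ‖E_A(x rᵢ x*)‖₂²` for all partitions (`IsTracialRep.exists_lower_bound`).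

**Intertwiners from atoms.** Let `(r_b)` be a binary tree of projections generating `A`. On the
spectrum of `A`, the elements `g_b = E_A(x r_b x*)` form a field of measures on the boundary of the
tree, and the lower bound forces these measures to have atoms of size at least a fixed `c'` on a set
of positive measure. Choosing such an atom measurably amounts to a second tree `(q_b)` of
projections of `A`, and `y = lim ∑ q_b x r_b` is a nonzero element with `y r_b = q_b y`
(`IsTracialRep.exists_intertwiner`). The elements `y* r_b y` then lie in `A`, and since `τ` is a
trace the sums `∑ ‖y* r_b y‖₂²` are bounded below too (`IsTracialRep.sum_norm_conj_lower_bound`).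
So `y*` may take the place of `x`, and the result is a `z ≠ 0` with `E_A(z) = 0` that intertwines
`(r_b)` with projections of `A` on both sides.

**Singularity.** The polar part of `z`, cut down by a spectral projection of `z* z`, is a nonzero
partial isometry `w` with `w A w* ⊆ A` and `w* A w ⊆ A`. If a projection `r ≤ w* w` of `A` is
orthogonal to `w r w*`, then `w r + r w* + (1 - r - w r w*)` is a unitary normalizing `A`, so it
lies in `A` and `r = 0`. Hence `r ≤ w r w*` for every projection `r ≤ w* w` of `A`, with equality
because both sides have the same trace, so that `w` commutes with `A` and lies in it, which
contradicts `E_A(z) = 0` (`IsTracialRep.eq_zero_of_intertwines`). This proves the convergence of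
the averages; the statement on single powers of `v` follows from it by polarization.

The argument only uses a few properties of `M`, collected in `IsTracialRep`: the trace is a vector
state of some representation, balls of `M` are complete for the two-norm, and `M` contains some
spectral projections and continuous functions of its self-adjoint elements. For a von Neumann
algebra with a faithful normal tracial state they hold in a countable multiple of the given
representation (`IsFaithfulNormalTracialState.exists_isTracialRep`).
-/

namespace MasaWAHP

open Filter Topology

/-! ### Tracial representations -/

section Abstract

variable {R : Type*} [Ring R] [StarRing R] [Algebra ℂ R]
variable {K : Type*} [NormedAddCommGroup K] [InnerProductSpace ℂ K] [CompleteSpace K]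

/-- The properties of a finite von Neumann algebra with faithful normal trace `τ` on which the
argument rests. Here `π` is a representation on a Hilbert space `K` and the vector `Ω` of `K`
implements `τ`, so that `‖x‖₂ = ‖π x Ω‖`. The operator norm of `R` enters as `‖π x‖` only. -/
structure IsTracialRep (τ : R →ₗ[ℂ] ℂ) (π : R →⋆ₐ[ℂ] (K →L[ℂ] K)) (Ω : K) : Prop where
  apply : ∀ x, τ x = inner ℂ Ω (π x Ω)
  trace_one : τ 1 = 1
  tracial : ∀ x y, τ (x * y) = τ (y * x)
  faithful : ∀ x, π x Ω = 0 → x = 0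
  /-- Balls for the operator norm are complete for the two-norm. -/
  complete : ∀ (C : ℝ) (u : ℕ → R) (ξ : K), (∀ n, ‖π (u n)‖ ≤ C) →
    Tendsto (fun n => π (u n) Ω) atTop (𝓝 ξ) → ∃ y, ‖π y‖ ≤ C ∧ π y Ω = ξ
  /-- The spectral projection `e` of a self-adjoint `h` for `(0, ∞)`, with the square roots `s` and
  `t` of the positive and the negative part of `h`. -/
  sign : ∀ h : R, star h = h → ∃ e s t : R, star e = e ∧ e * e = e ∧ star s = s ∧ star t = t ∧
    h * e = s * s ∧ h * (1 - e) = -(t * t) ∧ (∀ y, s * y = 0 → e * y = 0) ∧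
    ∀ y, Commute h y → Commute e y ∧ Commute s y ∧ Commute t y
  /-- The inverse square root of `δ + s²`. -/
  invSqrt : ∀ (s : R) (δ : ℝ), star s = s → 0 < δ → ∃ k : R, star k = k ∧
    k * k * ((δ : ℂ) • 1 + s * s) = 1 ∧ ∀ y, Commute s y → Commute k y

/-- `A` is a masa generated by the unitary `v`, expressed by commutation in `R` only. -/
structure IsCyclicMasa [StarModule ℂ R] (A : StarSubalgebra ℂ R) (v : unitary R) : Prop where
  mem : (v : R) ∈ A
  comm : ∀ x ∈ A, ∀ y ∈ A, Commute x y
  masa : ∀ z : R, Commute (v : R) z → z ∈ A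

namespace IsTracialRep

variable {τ : R →ₗ[ℂ] ℂ} {π : R →⋆ₐ[ℂ] (K →L[ℂ] K)} {Ω : K} (h : IsTracialRep τ π Ω)
include h

lemma inner_eq (x y : R) : inner ℂ (π x Ω) (π y Ω) = τ (star x * y) := by
  rw [h.apply, map_mul, map_star, mul_apply_eq_comp, ContinuousLinearMap.star_eq_adjoint,
    ContinuousLinearMap.adjoint_inner_right]

lemma trace_star_mul_self (x : R) : τ (star x * x) = ((‖π x Ω‖ ^ 2 : ℝ) : ℂ) := by
  rw [← h.inner_eq, inner_self_eq_norm_sq_to_K]; norm_cast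

lemma twoNorm_eq (x : R) : twoNorm τ x = ‖π x Ω‖ := by
  rw [twoNorm, h.trace_star_mul_self, Complex.ofReal_re, Real.sqrt_sq (norm_nonneg _)]

lemma trace_star (x : R) : τ (star x) = starRingEnd ℂ (τ x) := by
  rw [h.apply, h.apply, map_star, ContinuousLinearMap.star_eq_adjoint,
    ContinuousLinearMap.adjoint_inner_right, inner_conj_symm]

lemma norm_star (x : R) : ‖π (star x) Ω‖ = ‖π x Ω‖ := by
  have h1 := h.trace_star_mul_self (star x)
  rw [star_star, h.tracial, h.trace_star_mul_self] at h1
  have h2 : ‖π x Ω‖ ^ 2 = ‖π (star x) Ω‖ ^ 2 := by exact_mod_cast h1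
  exact ((sq_eq_sq₀ (norm_nonneg _) (norm_nonneg _)).1 h2).symm

omit h in
lemma norm_rep_star (x : R) : ‖π (star x)‖ = ‖π x‖ := by
  rw [map_star, _root_.norm_star]

omit h in
lemma norm_mul_left (a x : R) : ‖π (a * x) Ω‖ ≤ ‖π a‖ * ‖π x Ω‖ := by
  rw [map_mul, mul_apply_eq_comp]; exact (π a).le_opNorm _

lemma norm_unitary_mul {u : R} (hu : star u * u = 1) (x : R) : ‖π (u * x) Ω‖ = ‖π x Ω‖ := by
  have h1 := h.trace_star_mul_self (u * x)
  rw [star_mul, mul_assoc, ← mul_assoc (star u), hu, one_mul, h.trace_star_mul_self] at h1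
  have h2 : ‖π x Ω‖ ^ 2 = ‖π (u * x) Ω‖ ^ 2 := by exact_mod_cast h1
  exact ((sq_eq_sq₀ (norm_nonneg _) (norm_nonneg _)).1 h2).symm

lemma norm_mul_unitary {u : R} (hu : u * star u = 1) (x : R) : ‖π (x * u) Ω‖ = ‖π x Ω‖ := by
  rw [← h.norm_star, star_mul, h.norm_unitary_mul (by rwa [star_star]), h.norm_star]

lemma ext {x y : R} (hxy : π x Ω = π y Ω) : x = y :=
  sub_eq_zero.1 (h.faithful _ (by simp [hxy]))

lemma norm_trace_le (x y : R) : ‖τ (star x * y)‖ ≤ ‖π x Ω‖ * ‖π y Ω‖ := by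
  rw [← h.inner_eq]; exact norm_inner_le_norm _ _

omit h in
/-- A two-norm limit commutes with left multiplication. -/
lemma tendsto_mul_left {u : ℕ → R} {y : R} (hu : Tendsto (fun n => π (u n) Ω) atTop (𝓝 (π y Ω)))
    (a : R) : Tendsto (fun n => π (a * u n) Ω) atTop (𝓝 (π (a * y) Ω)) := by
  simp only [map_mul, mul_apply_eq_comp]
  exact ((π a).continuous.tendsto _).comp hu

lemma tendsto_star {u : ℕ → R} {y : R} (hu : Tendsto (fun n => π (u n) Ω) atTop (𝓝 (π y Ω))) :
    Tendsto (fun n => π (star (u n)) Ω) atTop (𝓝 (π (star y) Ω)) := by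
  rw [tendsto_iff_norm_sub_tendsto_zero] at hu ⊢
  refine hu.congr fun n => ?_
  have e : ∀ x y : R, π x Ω - π y Ω = π (x - y) Ω := fun x y => by simp
  rw [e, e, ← star_sub, h.norm_star]

lemma tendsto_mul_right {u : ℕ → R} {y : R}
    (hu : Tendsto (fun n => π (u n) Ω) atTop (𝓝 (π y Ω))) (a : R) :
    Tendsto (fun n => π (u n * a) Ω) atTop (𝓝 (π (y * a) Ω)) := by
  have := h.tendsto_star (tendsto_mul_left (h.tendsto_star hu) (star a))
  simpa using this

/-- On bounded sets multiplication is jointly continuous for the two-norm. -/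
lemma tendsto_mul {u w : ℕ → R} {y z : R} {C : ℝ} (hC : ∀ n, ‖π (u n)‖ ≤ C)
    (hu : Tendsto (fun n => π (u n) Ω) atTop (𝓝 (π y Ω)))
    (hw : Tendsto (fun n => π (w n) Ω) atTop (𝓝 (π z Ω))) :
    Tendsto (fun n => π (u n * w n) Ω) atTop (𝓝 (π (y * z) Ω)) := by
  have h1 : Tendsto (fun n => π (u n * (w n - z)) Ω) atTop (𝓝 0) := by
    rw [tendsto_iff_norm_sub_tendsto_zero] at hw
    refine squeeze_zero_norm (fun n => ?_) (by simpa using hw.const_mul C)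
    refine (norm_mul_left _ _).trans ?_
    rw [map_sub, sub_apply]
    exact mul_le_mul_of_nonneg_right (hC n) (norm_nonneg _)
  have h2 := h1.add (h.tendsto_mul_right hu z)
  rw [zero_add] at h2
  refine h2.congr fun n => ?_
  simp [mul_sub]

lemma tendsto_trace_mul {u : ℕ → R} {y : R}
    (hu : Tendsto (fun n => π (u n) Ω) atTop (𝓝 (π y Ω))) (a : R) :
    Tendsto (fun n => τ (a * u n)) atTop (𝓝 (τ (a * y))) := by
  simp only [h.apply]
  exact tendsto_const_nhds.inner (tendsto_mul_left hu a)

omit h in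
/-- The operator norm of a projection is at most `1`. -/
lemma norm_proj_le {e : R} (he : star e = e) (he' : e * e = e) : ‖π e‖ ≤ 1 := by
  have hs : star (π e) * π e = π e := by rw [← map_star, he, ← map_mul, he']
  have := CStarRing.norm_star_mul_self (x := π e)
  rw [hs] at this
  nlinarith [norm_nonneg (π e)]

omit h in
lemma norm_unitary_le (u : unitary R) : ‖π u‖ ≤ 1 := by
  have hs : star (π u) * π u = 1 := by rw [← map_star, ← map_mul]; simp
  have := CStarRing.norm_star_mul_self (x := π (u : R))
  rw [hs] at this
  nlinarith [norm_nonneg (π (u : R)),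
    (show ‖(1 : K →L[ℂ] K)‖ ≤ 1 from ContinuousLinearMap.norm_id_le)]

end IsTracialRep

end Abstract

/-! ### The conditional expectation onto a masa -/

section CondExp

variable {R : Type*} [Ring R] [StarRing R] [Algebra ℂ R] [StarModule ℂ R]
variable {K : Type*} [NormedAddCommGroup K] [InnerProductSpace ℂ K] [CompleteSpace K]
variable {τ : R →ₗ[ℂ] ℂ} {π : R →⋆ₐ[ℂ] (K →L[ℂ] K)} {Ω : K} {A : StarSubalgebra ℂ R}
  {v : unitary R}

lemma IsCyclicMasa.zpow_mem (hA : IsCyclicMasa A v) (k : ℤ) :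
    ((v ^ k : unitary R) : R) ∈ A := by
  have hs : ((v⁻¹ : unitary R) : R) ∈ A := by
    rw [← Unitary.star_eq_inv, Unitary.coe_star]; exact star_mem hA.mem
  obtain ⟨n, rfl | rfl⟩ := k.eq_nat_or_neg
  · rw [zpow_natCast, SubmonoidClass.coe_pow]; exact pow_mem hA.mem n
  · rw [zpow_neg, zpow_natCast, ← inv_pow, SubmonoidClass.coe_pow]; exact pow_mem hs n

/-- The projection of `x` to `A` exists. It is the vector of least two-norm among the elements of
operator norm at most that of `x` that have the same pairing with `A` as `x`: this set is invariant
under conjugation by `v`, so its least vector commutes with `v`. -/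
lemma IsTracialRep.exists_isProjTo (h : IsTracialRep τ π Ω) (hA : IsCyclicMasa A v) (x : R) :
    ∃ a, IsProjTo τ A x a ∧ ‖π a‖ ≤ ‖π x‖ := by
  set S : Set K := {ξ | ∃ y : R, ‖π y‖ ≤ ‖π x‖ ∧ (∀ b ∈ A, τ (b * y) = τ (b * x)) ∧ π y Ω = ξ}
    with hS
  have hne : S.Nonempty := ⟨π x Ω, x, le_rfl, fun _ _ => rfl, rfl⟩
  have hconv : Convex ℝ S := by
    rintro _ ⟨y, hy, hy', rfl⟩ _ ⟨z, hz, hz', rfl⟩ s t hs ht hst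
    have hst' : (s : ℂ) + t = 1 := by exact_mod_cast hst
    refine ⟨(s : ℂ) • y + (t : ℂ) • z, ?_, fun b hb => ?_, ?_⟩
    · rw [map_add, map_smul, map_smul]
      refine (norm_add_le _ _).trans ?_
      rw [norm_smul, norm_smul, Complex.norm_of_nonneg hs, Complex.norm_of_nonneg ht]
      calc s * ‖π y‖ + t * ‖π z‖ ≤ s * ‖π x‖ + t * ‖π x‖ := by gcongr
        _ = ‖π x‖ := by rw [← add_mul, hst, one_mul]
    · rw [mul_add, mul_smul_comm, mul_smul_comm, map_add, map_smul, map_smul, hy' b hb, hz' b hb,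
        ← add_smul, hst', one_smul]
    · rw [map_add, add_apply, map_smul, map_smul]; rfl
  have hclosed : IsClosed S := by
    refine isClosed_of_closure_subset fun ξ hξ => ?_
    obtain ⟨ζ, hζ, hlim⟩ := mem_closure_iff_seq_limit.1 hξ
    choose u hu hu' hu'' using hζ
    obtain ⟨y, hy, rfl⟩ := h.complete ‖π x‖ u ξ hu (by simpa only [hu''] using hlim)
    refine ⟨y, hy, fun b hb => ?_, rfl⟩
    refine tendsto_nhds_unique (h.tendsto_trace_mul (u := u) (by simpa only [hu''] using hlim) b) ?_
    simp only [hu' _ b hb]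
    exact tendsto_const_nhds
  let _ : InnerProductSpace ℝ K := InnerProductSpace.complexToReal
  obtain ⟨ξ, ⟨y, hy, hyA, rfl⟩, hmin⟩ :=
    exists_norm_eq_iInf_of_complete_convex hne hclosed.isComplete hconv 0
  have hle : ∀ η ∈ S, ‖π y Ω‖ ≤ ‖η‖ := fun η hη => by
    have : ‖(0 : K) - π y Ω‖ ≤ ‖(0 : K) - η‖ := by
      rw [hmin]
      exact ciInf_le ⟨0, by rintro _ ⟨w, rfl⟩; exact norm_nonneg _⟩ (⟨η, hη⟩ : S)
    simpa using this
  have hv1 : star (v : R) * v = 1 := Unitary.coe_star_mul_self v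
  have hv2 : (v : R) * star (v : R) = 1 := Unitary.coe_mul_star_self v
  have hconj : π (v * y * star (v : R)) Ω ∈ S := by
    refine ⟨_, ?_, fun b hb => ?_, rfl⟩
    · rw [map_mul, map_mul]
      calc ‖π v * π y * π (star (v : R))‖ ≤ ‖π v‖ * ‖π y‖ * ‖π (star (v : R))‖ :=
            (norm_mul_le _ _).trans (by gcongr; exact norm_mul_le _ _)
        _ ≤ 1 * ‖π y‖ * 1 := by
            rw [IsTracialRep.norm_rep_star]
            gcongr <;> exact IsTracialRep.norm_unitary_le v
        _ ≤ ‖π x‖ := by simpa using hy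
    · rw [h.tracial, ← hyA b hb, mul_assoc, mul_assoc, h.tracial, mul_assoc, mul_assoc,
        (hA.comm b hb _ hA.mem).eq, ← mul_assoc (star _), hv1, one_mul, h.tracial]
  -- Two vectors of least norm in a convex set coincide.
  have heq : π (v * y * star (v : R)) Ω = π y Ω := by
    have hn : ‖π (v * y * star (v : R)) Ω‖ = ‖π y Ω‖ := by
      rw [h.norm_mul_unitary (by rw [star_star]; exact hv1), h.norm_unitary_mul hv1]
    have hmid := hle _ (hconv hconj ⟨y, hy, hyA, rfl⟩ (a := 1 / 2) (b := 1 / 2)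
      (by norm_num) (by norm_num) (by norm_num))
    rw [← smul_add, norm_smul, Real.norm_of_nonneg (by norm_num : (0 : ℝ) ≤ 1 / 2)] at hmid
    have hp := parallelogram_law_with_norm ℂ (π (v * y * star (v : R)) Ω) (π y Ω)
    rw [hn] at hp
    have h0 : ‖π (v * y * star (v : R)) Ω - π y Ω‖ = 0 := by
      nlinarith [norm_nonneg (π y Ω), norm_nonneg (π (v * y * star (v : R)) Ω - π y Ω)]
    exact sub_eq_zero.1 (norm_eq_zero.1 h0)
  refine ⟨y, ⟨hA.masa y ?_, fun b hb => ?_⟩, hy⟩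
  · have h1 := h.ext heq
    calc (v : R) * y = v * y * (star (v : R) * v) := by rw [hv1, mul_one]
      _ = y * v := by rw [← mul_assoc, h1]
  · rw [mul_sub, map_sub, hyA _ (star_mem hb), sub_self]

end CondExp

namespace IsTracialRep

variable {R : Type*} [Ring R] [StarRing R] [Algebra ℂ R] [StarModule ℂ R]
variable {K : Type*} [NormedAddCommGroup K] [InnerProductSpace ℂ K] [CompleteSpace K]
variable {τ : R →ₗ[ℂ] ℂ} {π : R →⋆ₐ[ℂ] (K →L[ℂ] K)} {Ω : K} {A : StarSubalgebra ℂ R}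
  {v : unitary R} (h : IsTracialRep τ π Ω) (hA : IsCyclicMasa A v)
include h

lemma eq_of_isProjTo {x a b : R} (ha : IsProjTo τ A x a) (hb : IsProjTo τ A x b) : a = b := by
  refine ha.unique (fun y hy => h.faithful _ ?_) hb
  rw [h.trace_star_mul_self] at hy
  simpa using hy

include hA

lemma condExp_isProjTo (x : R) : IsProjTo τ A x (condExp τ A x) := by
  have hx : ∃ a, IsProjTo τ A x a := (h.exists_isProjTo hA x).imp fun _ => And.left
  rw [condExp, dif_pos hx]
  exact hx.choose_spec

lemma condExp_mem (x : R) : condExp τ A x ∈ A := (h.condExp_isProjTo hA x).1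

lemma trace_mul_condExp {b : R} (hb : b ∈ A) (x : R) : τ (b * condExp τ A x) = τ (b * x) := by
  have := (h.condExp_isProjTo hA x).2 (star b) (star_mem hb)
  rw [star_star, mul_sub, map_sub, sub_eq_zero] at this
  exact this.symm

lemma trace_condExp_mul {b : R} (hb : b ∈ A) (x : R) : τ (condExp τ A x * b) = τ (x * b) := by
  rw [h.tracial, h.trace_mul_condExp hA hb, h.tracial]

lemma condExp_eq {x a : R} (ha : a ∈ A) (hax : ∀ b ∈ A, τ (b * a) = τ (b * x)) :
    condExp τ A x = a := by
  refine h.eq_of_isProjTo (h.condExp_isProjTo hA x) ⟨ha, fun b hb => ?_⟩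
  rw [mul_sub, map_sub, hax _ (star_mem hb), sub_self]

lemma condExp_eq_zero_iff {x : R} : condExp τ A x = 0 ↔ ∀ b ∈ A, τ (b * x) = 0 := by
  refine ⟨fun hx b hb => ?_, fun hx => h.condExp_eq hA (zero_mem _) fun b hb => ?_⟩
  · rw [← h.trace_mul_condExp hA hb, hx, mul_zero, map_zero]
  · rw [hx b hb, mul_zero, map_zero]

lemma condExp_of_mem {a : R} (ha : a ∈ A) : condExp τ A a = a :=
  h.condExp_eq hA ha fun _ _ => rfl

lemma norm_condExp_le (x : R) : ‖π (condExp τ A x)‖ ≤ ‖π x‖ := by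
  obtain ⟨a, ha, hn⟩ := h.exists_isProjTo hA x
  rwa [h.eq_of_isProjTo (h.condExp_isProjTo hA x) ha]

lemma condExp_add (x y : R) : condExp τ A (x + y) = condExp τ A x + condExp τ A y :=
  h.condExp_eq hA (add_mem (h.condExp_mem hA x) (h.condExp_mem hA y)) fun b hb => by
    rw [mul_add, mul_add, map_add, map_add, h.trace_mul_condExp hA hb, h.trace_mul_condExp hA hb]

lemma condExp_smul (c : ℂ) (x : R) : condExp τ A (c • x) = c • condExp τ A x :=
  h.condExp_eq hA (A.smul_mem (h.condExp_mem hA x) c) fun b hb => by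
    rw [mul_smul_comm, mul_smul_comm, map_smul, map_smul, h.trace_mul_condExp hA hb]

lemma condExp_neg (x : R) : condExp τ A (-x) = -condExp τ A x := by
  simpa using h.condExp_smul hA (-1) x

lemma condExp_sub (x y : R) : condExp τ A (x - y) = condExp τ A x - condExp τ A y := by
  rw [sub_eq_add_neg, h.condExp_add hA, h.condExp_neg hA, ← sub_eq_add_neg]

lemma condExp_star (x : R) : condExp τ A (star x) = star (condExp τ A x) :=
  h.condExp_eq hA (star_mem (h.condExp_mem hA x)) fun b hb => by
    rw [← star_star b, ← star_mul, ← star_mul, h.trace_star, h.trace_star,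
      h.trace_condExp_mul hA (star_mem hb)]

lemma condExp_mul_left {a : R} (ha : a ∈ A) (x : R) :
    condExp τ A (a * x) = a * condExp τ A x :=
  h.condExp_eq hA (mul_mem ha (h.condExp_mem hA x)) fun b hb => by
    rw [← mul_assoc, ← mul_assoc, h.trace_mul_condExp hA (mul_mem hb ha)]

lemma condExp_mul_right {a : R} (ha : a ∈ A) (x : R) :
    condExp τ A (x * a) = condExp τ A x * a :=
  h.condExp_eq hA (mul_mem (h.condExp_mem hA x) ha) fun b hb => by
    rw [← mul_assoc, h.tracial, ← mul_assoc, h.trace_mul_condExp hA (mul_mem ha hb),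
      mul_assoc, h.tracial a, mul_assoc]

lemma condExp_sum {ι : Type*} (s : Finset ι) (x : ι → R) :
    condExp τ A (∑ i ∈ s, x i) = ∑ i ∈ s, condExp τ A (x i) := by
  classical
  induction s using Finset.induction_on with
  | empty => simpa using h.condExp_of_mem hA (zero_mem A)
  | insert i s hi ih => rw [Finset.sum_insert hi, Finset.sum_insert hi, h.condExp_add hA, ih]

end IsTracialRep

/-! ### Positivity and the Cauchy-Schwarz inequality for the conditional expectation -/

/-- The commutative ring structure of a masa. -/
abbrev IsCyclicMasa.commRing {R : Type*} [Ring R] [StarRing R] [Algebra ℂ R] [StarModule ℂ R]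
    {A : StarSubalgebra ℂ R} {v : unitary R} (hA : IsCyclicMasa A v) : CommRing A :=
  { (inferInstance : Ring A) with
    mul_comm := fun x y => Subtype.ext (hA.comm x x.2 y y.2).eq }

namespace IsTracialRep

variable {R : Type*} [Ring R] [StarRing R] [Algebra ℂ R] [StarModule ℂ R]
variable {K : Type*} [NormedAddCommGroup K] [InnerProductSpace ℂ K] [CompleteSpace K]
variable {τ : R →ₗ[ℂ] ℂ} {π : R →⋆ₐ[ℂ] (K →L[ℂ] K)} {Ω : K} {A : StarSubalgebra ℂ R}
  {v : unitary R} (h : IsTracialRep τ π Ω) (hA : IsCyclicMasa A v)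
include h hA

/-- The conditional expectation is positive: `E_A(s s*)` is a square. -/
lemma exists_condExp_mul_star (s : R) :
    ∃ p ∈ A, star p = p ∧ condExp τ A (s * star s) = p * p := by
  set g := condExp τ A (s * star s) with hg
  have hgA : g ∈ A := h.condExp_mem hA _
  have hgs : star g = g := by rw [hg, ← h.condExp_star hA, star_mul, star_star]
  obtain ⟨e, p, q, he, he2, hp, hq, hge, hgf, -, hcomm⟩ := h.sign g hgs
  have hvg : Commute g v := hA.comm _ hgA _ hA.mem
  have heA : e ∈ A := hA.masa _ (hcomm _ hvg).1.symm
  have hfA : 1 - e ∈ A := sub_mem (one_mem _) heA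
  have hf2 : (1 - e) * (1 - e) = 1 - e := by
    rw [mul_sub, mul_one, sub_mul, one_mul, he2, sub_self, sub_zero]
  have hq0 : q = 0 := by
    refine h.faithful q ?_
    have h1 : τ (star q * q) = -τ (star (star s * (1 - e)) * (star s * (1 - e))) := by
      rw [hq, ← neg_neg (q * q), ← hgf, map_neg, h.trace_condExp_mul hA hfA, star_mul, star_star,
        star_sub, star_one, he, h.tracial ((1 - e) * s)]
      rw [mul_assoc s, h.tracial s, mul_assoc (star s), mul_assoc (star s),
        ← mul_assoc (1 - e) (1 - e), hf2]
    rw [h.trace_star_mul_self, h.trace_star_mul_self] at h1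
    have h2 : ‖π q Ω‖ ^ 2 = -‖π (star s * (1 - e)) Ω‖ ^ 2 := by exact_mod_cast h1
    have h3 : ‖π q Ω‖ = 0 := by
      nlinarith [sq_nonneg ‖π q Ω‖, sq_nonneg ‖π (star s * (1 - e)) Ω‖]
    exact norm_eq_zero.1 h3
  refine ⟨p, hA.masa _ (hcomm _ hvg).2.1.symm, hp, ?_⟩
  rw [hq0, mul_zero, neg_zero, mul_sub, mul_one, sub_eq_zero] at hgf
  rw [← hge, ← hgf]

/-- Cauchy-Schwarz inequality `‖E_A(s u s*)‖₂ ≤ ‖E_A(s s*)‖₂`. In the commutative algebra `A` it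
says `|b|² ≤ g²` for `b = E_A(s u s*)`, `g = E_A(s s*)`, and it follows from `τ(ζ ζ*) ≥ 0` for
`ζ = m^{-1/2} (b* s u - m s)` with `m = g + ε`. -/
lemma norm_condExp_conj_le (s : R) {u : R} (hu : u * star u = 1) :
    ‖π (condExp τ A (s * u * star s)) Ω‖ ≤ ‖π (condExp τ A (s * star s)) Ω‖ := by
  obtain ⟨p, hpA, hp, hgp⟩ := h.exists_condExp_mul_star hA s
  set b := condExp τ A (s * u * star s) with hb
  set g := condExp τ A (s * star s) with hg
  have hbA : b ∈ A := h.condExp_mem hA _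
  have hgA : g ∈ A := h.condExp_mem hA _
  have hbsA : star b ∈ A := star_mem hbA
  have hbs : condExp τ A (s * star u * star s) = star b := by
    rw [hb, ← h.condExp_star hA]; simp [mul_assoc]
  have key : ∀ ε : ℝ, 0 < ε →
      ‖π b Ω‖ ^ 2 ≤ ‖π g Ω‖ ^ 2 + ε * ‖π p Ω‖ ^ 2 := by
    intro ε hε
    obtain ⟨k, hk, hkm, hkc⟩ := h.invSqrt p ε hp hε
    rw [← hgp] at hkm
    set m : R := (ε : ℂ) • 1 + g with hm
    have hkA : k ∈ A := hA.masa _ (hkc _ (hA.comm _ hpA _ hA.mem)).symm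
    have hmA : m ∈ A := add_mem (A.smul_mem (one_mem _) _) hgA
    have hms : star m = m := by
      rw [hm, star_add, star_smul, star_one, hgp, star_mul, hp]; simp
    -- `τ(a s w s* c) = τ(a E_A(s w s*) c)` for `a`, `c` in `A`
    have hE : ∀ a ∈ A, ∀ c ∈ A, ∀ w : R,
        τ (a * (w * c)) = τ (a * (condExp τ A w * c)) := by
      intro a ha c hc w
      rw [← mul_assoc, h.tracial, ← mul_assoc, ← h.trace_mul_condExp hA (mul_mem hc ha),
        mul_assoc, h.tracial, mul_assoc]
    have e0 := h.trace_star_mul_self (star (k * (star b * (s * u) - m * s)))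
    have e1 : star (star (k * (star b * (s * u) - m * s))) *
        star (k * (star b * (s * u) - m * s)) =
        k * ((star b * (s * star s) * b - star b * (s * u * star s) * m
          - m * (s * star u * star s) * b + m * (s * star s) * m) * k) := by
      simp only [star_star, star_mul, star_sub, hk, hms]
      have : star b * (s * u) * (star u * star s * b) = star b * (s * star s) * b := by
        rw [show star b * (s * u) * (star u * star s * b) = star b * (s * (u * star u) * star s) * b
          by noncomm_ring, hu, mul_one]
      calc _ = k * ((star b * (s * u) * (star u * star s * b) - star b * (s * u * star s) * m
          - m * (s * star u * star s) * b + m * (s * star s) * m) * k) := by noncomm_ring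
        _ = _ := by rw [this]
    have e2 : τ (k * ((star b * (s * star s) * b - star b * (s * u * star s) * m
          - m * (s * star u * star s) * b + m * (s * star s) * m) * k)) =
        τ (star b * b) - ε * τ (star (b * k) * (b * k)) - 2 * τ (star b * b)
          + (ε * τ (star p * p) + τ (star g * g)) := by
      have c1 : k * ((star b * (s * star s) * b - star b * (s * u * star s) * m
          - m * (s * star u * star s) * b + m * (s * star s) * m) * k)
          = k * star b * ((s * star s) * (b * k)) - k * star b * ((s * u * star s) * (m * k))
          - k * m * ((s * star u * star s) * (b * k)) + k * m * ((s * star s) * (m * k)) := by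
        noncomm_ring
      rw [c1, map_add, map_sub, map_sub, hE _ (mul_mem hkA hbsA) _ (mul_mem hbA hkA),
        hE _ (mul_mem hkA hbsA) _ (mul_mem hmA hkA), hE _ (mul_mem hkA hmA) _ (mul_mem hbA hkA),
        hE _ (mul_mem hkA hmA) _ (mul_mem hmA hkA), hbs, ← hb, ← hg]
      let _ := hA.commRing
      have hcA : (ε : ℂ) • (1 : R) ∈ A := A.smul_mem (one_mem _) _
      have comb : ∀ k m b bs g c : A, k * k * m = 1 → m = c + g →
          k * bs * (g * (b * k)) = bs * b - c * (k * bs * (b * k)) ∧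
          k * bs * (b * (m * k)) = bs * b ∧ k * m * (bs * (b * k)) = bs * b ∧
          k * m * (g * (m * k)) = c * g + g * g := by
        intro k m b bs g c h1 h2
        refine ⟨?_, ?_, ?_, ?_⟩
        · linear_combination bs * b * h1 - k * bs * b * k * h2
        · linear_combination bs * b * h1
        · linear_combination bs * b * h1
        · linear_combination g * m * h1 + g * h2
      obtain ⟨d1, d2, d3, d4⟩ := comb ⟨k, hkA⟩ ⟨m, hmA⟩ ⟨b, hbA⟩ ⟨star b, hbsA⟩ ⟨g, hgA⟩ ⟨_, hcA⟩
        (Subtype.ext hkm) (Subtype.ext hm)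
      replace d1 : k * star b * (g * (b * k)) =
          star b * b - (ε : ℂ) • (star (b * k) * (b * k)) := by
        simpa [hk] using congrArg Subtype.val d1
      replace d2 : k * star b * (b * (m * k)) = star b * b := congrArg Subtype.val d2
      replace d3 : k * m * (star b * (b * k)) = star b * b := congrArg Subtype.val d3
      replace d4 : k * m * (g * (m * k)) = (ε : ℂ) • (star p * p) + star g * g := by
        have hgs : star g = g := by rw [hgp, star_mul, hp]
        rw [hgs, hp, ← hgp]
        simpa using congrArg Subtype.val d4
      rw [d1, d2, d3, d4, map_sub, map_add, map_smul, map_smul, smul_eq_mul, smul_eq_mul]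
      ring
    rw [e1, e2, h.trace_star_mul_self, h.trace_star_mul_self, h.trace_star_mul_self,
      h.trace_star_mul_self] at e0
    have e3 : ‖π b Ω‖ ^ 2 - ε * ‖π (b * k) Ω‖ ^ 2 - 2 * ‖π b Ω‖ ^ 2 +
        (ε * ‖π p Ω‖ ^ 2 + ‖π g Ω‖ ^ 2) =
        ‖π (star (k * (star b * (s * u) - m * s))) Ω‖ ^ 2 := by exact_mod_cast e0
    nlinarith [sq_nonneg ‖π (star (k * (star b * (s * u) - m * s))) Ω‖,
      mul_nonneg hε.le (sq_nonneg ‖π (b * k) Ω‖)]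
  refine abs_le_of_sq_le_sq' (le_of_forall_pos_le_add fun δ hδ => ?_) (norm_nonneg _) |>.2
  have hP : 0 < ‖π p Ω‖ ^ 2 + 1 := by positivity
  refine (key (δ / (‖π p Ω‖ ^ 2 + 1)) (by positivity)).trans ?_
  have : δ / (‖π p Ω‖ ^ 2 + 1) * ‖π p Ω‖ ^ 2 ≤ δ := by
    rw [div_mul_eq_mul_div, div_le_iff₀ hP]
    nlinarith [sq_nonneg ‖π p Ω‖]
  linarith

end IsTracialRep

/-! ### Averages over powers of the generator and partitions of the masa -/

section WeakLimit

variable {K : Type*} [NormedAddCommGroup K] [InnerProductSpace ℂ K] [CompleteSpace K]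

/-- A bounded sequence of operators converges weakly along every ultrafilter. -/
lemma exists_weak_limit (T : ℕ → K →L[ℂ] K) {C : ℝ} (hT : ∀ n, ‖T n‖ ≤ C) (U : Ultrafilter ℕ) :
    ∃ S : K →L[ℂ] K, ∀ ξ η : K,
      Tendsto (fun n => inner ℂ (T n ξ) η) (U : Filter ℕ) (𝓝 (inner ℂ (S ξ) η)) := by
  have hb : ∀ ξ η n, ‖inner ℂ (T n ξ) η‖ ≤ C * ‖ξ‖ * ‖η‖ := fun ξ η n =>
    (norm_inner_le_norm _ _).trans (mul_le_mul_of_nonneg_right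
      (((T n).le_opNorm ξ).trans (mul_le_mul_of_nonneg_right (hT n) (norm_nonneg _)))
      (norm_nonneg _))
  have hex : ∀ ξ η, ∃ l : ℂ, ‖l‖ ≤ C * ‖ξ‖ * ‖η‖ ∧
      Tendsto (fun n => inner ℂ (T n ξ) η) (U : Filter ℕ) (𝓝 l) := by
    intro ξ η
    obtain ⟨l, hl, hlim⟩ := (isCompact_closedBall (0 : ℂ) (C * ‖ξ‖ * ‖η‖)).ultrafilter_le_nhds'
      (U.map fun n => inner ℂ (T n ξ) η)
      (Ultrafilter.mem_map.2 (univ_mem' fun n => by simpa using hb ξ η n))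
    exact ⟨l, by simpa using hl, hlim⟩
  choose B hB hlim using hex
  let B' : K →L⋆[ℂ] K →L[ℂ] ℂ := LinearMap.mkContinuous₂
    (LinearMap.mk₂'ₛₗ (starRingEnd ℂ) (RingHom.id ℂ) B
      (fun ξ ξ' η => tendsto_nhds_unique (hlim _ _) (by
        simpa only [map_add, inner_add_left] using (hlim ξ η).add (hlim ξ' η)))
      (fun c ξ η => tendsto_nhds_unique (hlim _ _) (by
        simpa only [map_smul, inner_smul_left, smul_eq_mul] using
          (hlim ξ η).const_mul (starRingEnd ℂ c)))
      (fun ξ η η' => tendsto_nhds_unique (hlim _ _) (by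
        simpa only [inner_add_right] using (hlim ξ η).add (hlim ξ η')))
      (fun c ξ η => tendsto_nhds_unique (hlim _ _) (by
        simpa only [inner_smul_right, smul_eq_mul, RingHom.id_apply] using
          (hlim ξ η).const_mul c))) C hB
  refine ⟨InnerProductSpace.continuousLinearMapOfBilin B', fun ξ η => ?_⟩
  rw [InnerProductSpace.continuousLinearMapOfBilin_apply]
  exact hlim ξ η

end WeakLimit

/-- Telescoping over a symmetric interval. -/
lemma sum_Icc_sub_pred (f : ℤ → ℂ) (N : ℕ) :
    ∑ k ∈ Finset.Icc (-(N : ℤ)) N, (f (k - 1) - f k) = f (-(N : ℤ) - 1) - f N := by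
  induction N with
  | zero => simp
  | succ N ih =>
    push_cast
    rw [Finset.sum_Icc_succ_eq_add_endpoints, ih, add_sub_cancel_right, neg_add, ← sub_eq_add_neg]
    ring

namespace IsTracialRep

variable {R : Type*} [Ring R] [StarRing R] [Algebra ℂ R] [StarModule ℂ R]
variable {K : Type*} [NormedAddCommGroup K] [InnerProductSpace ℂ K] [CompleteSpace K]
variable {τ : R →ₗ[ℂ] ℂ} {π : R →⋆ₐ[ℂ] (K →L[ℂ] K)} {Ω : K} {A : StarSubalgebra ℂ R}
  {v : unitary R} (h : IsTracialRep τ π Ω) (hA : IsCyclicMasa A v)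
include h hA

/-- The conditional expectation is implemented by the projection of `K` onto the closure of
`A Ω`. -/
lemma exists_projection : ∃ P : K →L[ℂ] K, ∀ y, P (π y Ω) = π (condExp τ A y) Ω := by
  let f : R →ₗ[ℂ] K := (ContinuousLinearMap.apply ℂ K Ω).toLinearMap ∘ₗ (π : R →ₗ[ℂ] (K →L[ℂ] K))
  let V : Submodule ℂ K := (A.toSubalgebra.toSubmodule.map f).topologicalClosure
  have hV : IsClosed (V : Set K) := Submodule.isClosed_topologicalClosure _
  have : CompleteSpace V := hV.completeSpace_coe
  have hf : ∀ y, f y = π y Ω := fun y => rfl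
  refine ⟨V.starProjection, fun y => ?_⟩
  refine Submodule.eq_starProjection_of_mem_orthogonal ?_ ?_
  · exact Submodule.le_topologicalClosure _
      (Submodule.mem_map.2 ⟨_, h.condExp_mem hA y, hf _⟩)
  · rw [Submodule.orthogonal_closure]
    rintro _ ⟨b, hb, rfl⟩
    rw [hf, ← sub_apply, ← map_sub, h.inner_eq]
    exact (h.condExp_isProjTo hA y).2 b hb

/-- If the averages of `‖E_A(x v^k x*)‖₂²` do not tend to `0`, then
`∑ᵢ ‖E_A(x rᵢ x*)‖₂²` is bounded below for all finite partitions `(rᵢ)` of the unit in `A`.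
The reason: a weak limit `T` of the averages of `v^k x* e_A x v^{-k}` commutes with `v`, hence with
`A`, so that `⟨T x*Ω, x*Ω⟩ = ∑ᵢ ⟨T rᵢ x*Ω, rᵢ x*Ω⟩`. -/
lemma exists_lower_bound
    (hcomm : ∀ S : K →L[ℂ] K, Commute S (π v) → Commute S (π (star (v : R))) →
      ∀ a ∈ A, Commute S (π a)) (x : R)
    (hx : ¬ Tendsto (fun N : ℕ => (1 / (2 * (N : ℝ) + 1)) * ∑ k ∈ Finset.Icc (-(N : ℤ)) (N : ℤ),
      ‖π (condExp τ A (x * ((v ^ k : unitary R) : R) * star x)) Ω‖ ^ 2) atTop (𝓝 0)) :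
    ∃ c : ℝ, 0 < c ∧ ∀ {ι : Type} (s : Finset ι) (r : ι → R),
      (∀ i ∈ s, r i ∈ A ∧ star (r i) = r i ∧ r i * r i = r i) → ∑ i ∈ s, r i = 1 →
      c ≤ ∑ i ∈ s, ‖π (condExp τ A (x * r i * star x)) Ω‖ ^ 2 := by
  obtain ⟨P, hPE⟩ := h.exists_projection hA
  set w : ℤ → R := fun k => ((v ^ k : unitary R) : R) with hw
  have hwv : ∀ k, star (w k) * v = star (w (k - 1)) := fun k => by
    rw [hw]
    simp only [← Unitary.coe_star, ← Submonoid.coe_mul, Unitary.star_eq_inv, ← zpow_neg]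
    rw [← zpow_add_one]; congr 2; ring
  set B : ℤ → K →L[ℂ] K := fun k => P * π (x * star (w k)) with hB
  set T : ℕ → K →L[ℂ] K := fun N =>
    (1 / (2 * (N : ℂ) + 1)) • ∑ k ∈ Finset.Icc (-(N : ℤ)) (N : ℤ), star (B k) * B k with hT
  -- the quadratic form of `T N`
  have hTq : ∀ N ξ η, inner ℂ (T N ξ) η =
      (1 / (2 * (N : ℂ) + 1)) * ∑ k ∈ Finset.Icc (-(N : ℤ)) (N : ℤ), inner ℂ (B k ξ) (B k η) := by
    intro N ξ η
    simp only [hT]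
    rw [smul_apply, inner_smul_left, sum_apply, sum_inner]
    congr 1
    · simp [Complex.conj_ofNat]
    · refine Finset.sum_congr rfl fun k _ => ?_
      rw [mul_apply_eq_comp, ContinuousLinearMap.star_eq_adjoint,
        ContinuousLinearMap.adjoint_inner_left]
  set C : ℝ := ‖P‖ * ‖π x‖ with hC
  have hBn : ∀ k, ‖B k‖ ≤ C := fun k => by
    refine (norm_mul_le _ _).trans (mul_le_mul_of_nonneg_left ?_ (norm_nonneg _))
    rw [map_mul]
    refine (norm_mul_le _ _).trans ?_
    have := norm_unitary_le (π := π) (star (v ^ k))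
    exact mul_le_of_le_one_right (norm_nonneg _) this
  have hBxi : ∀ k ξ η, ‖inner ℂ (B k ξ) (B k η)‖ ≤ C ^ 2 * ‖ξ‖ * ‖η‖ := fun k ξ η => by
    calc ‖inner ℂ (B k ξ) (B k η)‖ ≤ ‖B k ξ‖ * ‖B k η‖ := norm_inner_le_norm _ _
      _ ≤ (C * ‖ξ‖) * (C * ‖η‖) := by
        gcongr
        · exact (B k).le_of_opNorm_le (hBn k) ξ
        · exact (B k).le_of_opNorm_le (hBn k) η
      _ = _ := by ring
  have hcard : ∀ N : ℕ, ((Finset.Icc (-(N : ℤ)) (N : ℤ)).card : ℝ) = 2 * N + 1 := fun N => by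
    rw [Int.card_Icc]
    have : ((N : ℤ) + 1 - -(N : ℤ)).toNat = 2 * N + 1 := by omega
    rw [this]; push_cast; ring
  have hnormN : ∀ N : ℕ, ‖(1 / (2 * (N : ℂ) + 1))‖ = 1 / (2 * (N : ℝ) + 1) := fun N => by
    rw [show (1 / (2 * (N : ℂ) + 1)) = ((1 / (2 * (N : ℝ) + 1) : ℝ) : ℂ) by push_cast; ring,
      Complex.norm_of_nonneg (by positivity)]
  have hTn : ∀ N, ‖T N‖ ≤ C ^ 2 := fun N => by
    simp only [hT]
    rw [norm_smul, hnormN]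
    calc 1 / (2 * (N : ℝ) + 1) * ‖∑ k ∈ Finset.Icc (-(N : ℤ)) (N : ℤ), star (B k) * B k‖
        ≤ 1 / (2 * (N : ℝ) + 1) * ∑ k ∈ Finset.Icc (-(N : ℤ)) (N : ℤ), C ^ 2 := by
          gcongr
          refine (norm_sum_le _ _).trans (Finset.sum_le_sum fun k _ => ?_)
          rw [CStarRing.norm_star_mul_self, ← sq]
          gcongr
          exact hBn k
      _ = C ^ 2 := by
          rw [Finset.sum_const, nsmul_eq_mul, hcard]
          field_simp
  -- an ultrafilter along which the averages are bounded below
  set f : ℕ → ℝ := fun N => (1 / (2 * (N : ℝ) + 1)) * ∑ k ∈ Finset.Icc (-(N : ℤ)) (N : ℤ),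
      ‖π (condExp τ A (x * w k * star x)) Ω‖ ^ 2 with hf
  have hf0 : ∀ N, 0 ≤ f N := fun N => by positivity
  obtain ⟨c, hc, hfreq⟩ : ∃ c > 0, ∃ᶠ N in atTop, c ≤ f N := by
    by_contra! hcon
    refine hx (tendsto_order.2 ⟨fun a ha => ?_, fun a ha => ?_⟩)
    · exact Eventually.of_forall fun N => ha.trans_le (hf0 N)
    · simpa using hcon a ha
  have hne : (atTop ⊓ 𝓟 {N | c ≤ f N} : Filter ℕ).NeBot := frequently_iff_neBot.1 hfreq
  set U : Ultrafilter ℕ := Ultrafilter.of (atTop ⊓ 𝓟 {N | c ≤ f N}) with hU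
  have hUle : (U : Filter ℕ) ≤ atTop ⊓ 𝓟 {N | c ≤ f N} := Ultrafilter.of_le _
  have hUtop : (U : Filter ℕ) ≤ atTop := hUle.trans inf_le_left
  have hUc : ∀ᶠ N in (U : Filter ℕ), c ≤ f N :=
    hUle.trans inf_le_right (mem_principal_self _)
  obtain ⟨S, hS⟩ := exists_weak_limit T hTn U
  -- `S` is invariant under conjugation by `v`
  have hSv : ∀ ξ η, inner ℂ (S (π v ξ)) (π v η) = inner ℂ (S ξ) η := by
    intro ξ η
    have hlim := (hS (π v ξ) (π v η)).sub (hS ξ η)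
    refine sub_eq_zero.1 (tendsto_nhds_unique hlim ?_)
    have h0 : Tendsto (fun N : ℕ => 1 / (2 * (N : ℝ) + 1) * (2 * (C ^ 2 * ‖ξ‖ * ‖η‖))) atTop
        (𝓝 0) := by
      have h1 : Tendsto (fun N : ℕ => 2 * (N : ℝ) + 1) atTop atTop :=
        tendsto_atTop_add_const_right _ _
          (tendsto_natCast_atTop_atTop.const_mul_atTop (by norm_num))
      simpa using (tendsto_const_nhds (x := (1 : ℝ))).div_atTop h1 |>.mul_const
        (2 * (C ^ 2 * ‖ξ‖ * ‖η‖))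
    refine squeeze_zero_norm (fun N => ?_) (h0.mono_left hUtop)
    have hBv : ∀ k ζ, B k (π v ζ) = B (k - 1) ζ := fun k ζ => by
      simp only [hB]
      rw [mul_apply_eq_comp, mul_apply_eq_comp, ← mul_apply_eq_comp (π _) (π _), ← map_mul,
        mul_assoc, hwv]
    rw [hTq, hTq, ← mul_sub, ← Finset.sum_sub_distrib]
    simp only [hBv]
    rw [sum_Icc_sub_pred (fun k => inner ℂ (B k ξ) (B k η)), norm_mul, hnormN]
    gcongr
    refine (norm_sub_le _ _).trans ?_
    linarith [hBxi (-(N : ℤ) - 1) ξ η, hBxi N ξ η]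
  have hv1 : star (π v) * π v = 1 := by rw [← map_star, ← map_mul]; simp
  have hv2 : π v * star (π v) = 1 := by rw [← map_star, ← map_mul]; simp
  have hconj : star (π v) * S * π v = S := by
    refine ContinuousLinearMap.ext fun ξ => ext_inner_right ℂ fun η => ?_
    rw [mul_apply_eq_comp, mul_apply_eq_comp, ContinuousLinearMap.star_eq_adjoint,
      ContinuousLinearMap.adjoint_inner_left]
    exact hSv ξ η
  have hSc1 : S * π v = π v * S := by
    calc S * π v = π v * star (π v) * S * π v := by rw [hv2, one_mul]
      _ = π v * (star (π v) * S * π v) := by noncomm_ring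
      _ = π v * S := by rw [hconj]
  have hSc2 : S * star (π v) = star (π v) * S := by
    calc S * star (π v) = star (π v) * S * π v * star (π v) := by rw [hconj]
      _ = star (π v) * S * (π v * star (π v)) := by noncomm_ring
      _ = star (π v) * S := by rw [hv2, mul_one]
  have hSA : ∀ a ∈ A, Commute S (π a) := hcomm S hSc1 (by rw [map_star]; exact hSc2)
  -- the form of `S` at vectors `s* Ω`
  have hnq : ∀ (N : ℕ) (r : R), inner ℂ (T N (π (r * star x) Ω)) (π (r * star x) Ω) =
      (((1 / (2 * (N : ℝ) + 1)) * ∑ k ∈ Finset.Icc (-(N : ℤ)) (N : ℤ),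
        ‖π (condExp τ A (x * star (w k) * r * star x)) Ω‖ ^ 2 : ℝ) : ℂ) := by
    intro N r
    rw [hTq]
    push_cast
    congr 1
    refine Finset.sum_congr rfl fun k _ => ?_
    rw [inner_self_eq_norm_sq_to_K]
    simp only [hB]
    rw [mul_apply_eq_comp, ← mul_apply_eq_comp (π _) (π _), ← map_mul, hPE, ← mul_assoc]
    rfl
  refine ⟨c, hc, fun {ι} s r hr hsum => ?_⟩
  have hS0 : c ≤ (inner ℂ (S (π (star x) Ω)) (π (star x) Ω)).re := by
    refine ge_of_tendsto ((Complex.continuous_re.tendsto _).comp (hS _ _)) (hUc.mono fun N hN => ?_)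
    have := hnq N 1
    rw [one_mul] at this
    rw [Function.comp_apply, this, Complex.ofReal_re]
    refine hN.trans (le_of_eq ?_)
    rw [hf]
    simp only [mul_one]
    congr 1
    refine Finset.sum_congr rfl fun k _ => ?_
    rw [← h.norm_star, ← h.condExp_star hA]
    simp [mul_assoc]
  have hSi : ∀ i ∈ s, (inner ℂ (S (π (r i * star x) Ω)) (π (r i * star x) Ω)).re ≤
      ‖π (condExp τ A (x * r i * star x)) Ω‖ ^ 2 := by
    intro i hi
    obtain ⟨hriA, hris, hri2⟩ := hr i hi
    refine le_of_tendsto ((Complex.continuous_re.tendsto _).comp (hS _ _))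
      (Eventually.of_forall fun N => ?_)
    rw [Function.comp_apply, hnq, Complex.ofReal_re]
    calc _ ≤ 1 / (2 * (N : ℝ) + 1) * ∑ k ∈ Finset.Icc (-(N : ℤ)) (N : ℤ),
          ‖π (condExp τ A (x * r i * star x)) Ω‖ ^ 2 := by
          gcongr with k _
          have hcs := h.norm_condExp_conj_le hA (x * r i) (u := star (w k))
            (by rw [star_star]; exact Unitary.coe_star_mul_self _)
          have hcm : r i * star (w k) = star (w k) * r i :=
            (hA.comm _ hriA _ (star_mem (hA.zpow_mem k))).eq
          have e1 : x * r i * star (w k) * star (x * r i) = x * star (w k) * r i * star x := by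
            rw [star_mul, hris, mul_assoc x, hcm, ← mul_assoc, ← mul_assoc, mul_assoc _ (r i) (r i),
              hri2]
          have e2 : x * r i * star (x * r i) = x * r i * star x := by
            rw [star_mul, hris, ← mul_assoc, mul_assoc _ (r i) (r i), hri2]
          rwa [e1, e2] at hcs
      _ = _ := by
          rw [Finset.sum_const, nsmul_eq_mul, hcard]
          field_simp
  have hdecomp : inner ℂ (S (π (star x) Ω)) (π (star x) Ω) =
      ∑ i ∈ s, inner ℂ (S (π (r i * star x) Ω)) (π (r i * star x) Ω) := by
    have e1 : π (star x) Ω = ∑ i ∈ s, π (r i * star x) Ω := by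
      rw [← sum_apply, ← map_sum, ← Finset.sum_mul, hsum, one_mul]
    conv_lhs => rw [e1, inner_sum, ← e1]
    refine Finset.sum_congr rfl fun i hi => ?_
    obtain ⟨hriA, hris, hri2⟩ := hr i hi
    have e2 : S (π (r i * star x) Ω) = π (r i) (S (π (star x) Ω)) := by
      rw [map_mul, mul_apply_eq_comp, ← mul_apply_eq_comp, (hSA _ hriA).eq, mul_apply_eq_comp]
    have e3 : π (r i * star x) Ω = star (π (r i)) (π (r i * star x) Ω) := by
      rw [← map_star, hris, ← mul_apply_eq_comp, ← map_mul, ← mul_assoc, hri2]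
    conv_lhs => rw [e3, ContinuousLinearMap.star_eq_adjoint,
      ContinuousLinearMap.adjoint_inner_right, ← e2]
  refine hS0.trans ?_
  rw [hdecomp, Complex.re_sum]
  exact Finset.sum_le_sum hSi

end IsTracialRep

/-! ### Dyadic trees of projections and block diagonal limits -/

/-- The words of length `n`, the `n`-th level of the binary tree. The children of the word `b` are
`true :: b` and `false :: b`, so that the descendants of `b` are the words with suffix `b`. -/
def level : ℕ → Finset (List Bool)
  | 0 => {[]}
  | n + 1 => (level n).image (List.cons true) ∪ (level n).image (List.cons false)

lemma mem_level {n : ℕ} {b : List Bool} : b ∈ level n ↔ b.length = n := by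
  induction n generalizing b with
  | zero => simp [level]
  | succ n ih =>
    rcases b with _ | ⟨_ | _, b⟩ <;> simp [level, ih]

lemma sum_level_succ {M : Type*} [AddCommMonoid M] (n : ℕ) (f : List Bool → M) :
    ∑ b ∈ level (n + 1), f b = ∑ b ∈ level n, (f (true :: b) + f (false :: b)) := by
  rw [level, Finset.sum_union, Finset.sum_image (by simp), Finset.sum_image (by simp),
    Finset.sum_add_distrib]
  rw [Finset.disjoint_left]
  simp

section Tree

variable {R : Type*} [Ring R] [StarRing R] [Algebra ℂ R] [StarModule ℂ R]

/-- A family of projections in `A` indexed by the binary tree such that every projection is the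
orthogonal sum of its two children. -/
structure IsProjTree (A : StarSubalgebra ℂ R) (p : List Bool → R) : Prop where
  mem : ∀ b, p b ∈ A
  star_eq : ∀ b, star (p b) = p b
  mul_self : ∀ b, p b * p b = p b
  add_children : ∀ b, p (true :: b) + p (false :: b) = p b
  mul_child : ∀ c b, p (c :: b) * p b = p (c :: b)
  orth : ∀ b, p (true :: b) * p (false :: b) = 0

/-- The tree of projections with given root that splits the projection at `b` by `f b`. -/
def projTree (p₀ : R) (f : List Bool → R) : List Bool → R
  | [] => p₀
  | true :: b => projTree p₀ f b * f b
  | false :: b => projTree p₀ f b * (1 - f b)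

variable {A : StarSubalgebra ℂ R} {v : unitary R}

lemma isProjTree_projTree (hA : IsCyclicMasa A v) {p₀ : R} {f : List Bool → R}
    (h₀ : p₀ ∈ A ∧ star p₀ = p₀ ∧ p₀ * p₀ = p₀)
    (hf : ∀ b, f b ∈ A ∧ star (f b) = f b ∧ f b * f b = f b) :
    IsProjTree A (projTree p₀ f) := by
  have hmul : ∀ p ∈ A, star p = p → p * p = p → ∀ q ∈ A, star q = q → q * q = q →
      (p * q ∈ A ∧ star (p * q) = p * q ∧ p * q * (p * q) = p * q) ∧ p * q * p = p * q := by
    intro p hp hps hp2 q hq hqs hq2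
    have hc := (hA.comm q hq p hp).eq
    refine ⟨⟨mul_mem hp hq, by rw [star_mul, hps, hqs, hc], ?_⟩, ?_⟩
    · rw [mul_assoc, ← mul_assoc q, hc, mul_assoc p q q, hq2, ← mul_assoc, hp2]
    · rw [mul_assoc, hc, ← mul_assoc, hp2]
  have hf' : ∀ b, 1 - f b ∈ A ∧ star (1 - f b) = 1 - f b ∧ (1 - f b) * (1 - f b) = 1 - f b := by
    intro b
    obtain ⟨h1, h2, h3⟩ := hf b
    refine ⟨sub_mem (one_mem _) h1, by rw [star_sub, star_one, h2], ?_⟩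
    rw [mul_sub, mul_one, sub_mul, one_mul, h3, sub_self, sub_zero]
  have hall : ∀ b, projTree p₀ f b ∈ A ∧ star (projTree p₀ f b) = projTree p₀ f b ∧
      projTree p₀ f b * projTree p₀ f b = projTree p₀ f b := by
    intro b
    induction b with
    | nil => exact h₀
    | cons c b ih =>
      cases c
      · exact (hmul _ ih.1 ih.2.1 ih.2.2 _ (hf' b).1 (hf' b).2.1 (hf' b).2.2).1
      · exact (hmul _ ih.1 ih.2.1 ih.2.2 _ (hf b).1 (hf b).2.1 (hf b).2.2).1
  refine ⟨fun b => (hall b).1, fun b => (hall b).2.1, fun b => (hall b).2.2, fun b => ?_,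
    fun c b => ?_, fun b => ?_⟩
  · simp only [projTree]
    rw [← mul_add, add_sub_cancel, mul_one]
  · cases c
    · exact (hmul _ (hall b).1 (hall b).2.1 (hall b).2.2 _ (hf' b).1 (hf' b).2.1 (hf' b).2.2).2
    · exact (hmul _ (hall b).1 (hall b).2.1 (hall b).2.2 _ (hf b).1 (hf b).2.1 (hf b).2.2).2
  · simp only [projTree]
    have hc := (hA.comm _ (hf b).1 _ (hall b).1).eq
    rw [mul_assoc, ← mul_assoc (f b), hc, mul_assoc _ (f b), mul_sub, mul_one, (hf b).2.2, sub_self,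
      mul_zero, mul_zero]

namespace IsProjTree

variable {p : List Bool → R} (hp : IsProjTree A p)
include hp

lemma mul_suffix (l b : List Bool) : p (l ++ b) * p b = p (l ++ b) := by
  induction l with
  | nil => exact hp.mul_self b
  | cons c l ih =>
    rw [List.cons_append, ← hp.mul_child, mul_assoc, ih]

lemma sum_level (n : ℕ) : ∑ b ∈ level n, p b = p [] := by
  induction n with
  | zero => simp [level]
  | succ n ih => rw [sum_level_succ, ← ih]; exact Finset.sum_congr rfl fun b _ => hp.add_children b

lemma orth' (b : List Bool) : p (false :: b) * p (true :: b) = 0 := by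
  have := congrArg star (hp.orth b)
  rwa [star_mul, hp.star_eq, hp.star_eq, star_zero] at this

lemma mul_left_child (c : Bool) (b : List Bool) : p b * p (c :: b) = p (c :: b) := by
  have := congrArg star (hp.mul_child c b)
  rwa [star_mul, hp.star_eq, hp.star_eq] at this

lemma mul_eq_zero {b c : List Bool} (hl : b.length = c.length) (hbc : b ≠ c) : p b * p c = 0 := by
  induction b generalizing c with
  | nil => exact absurd (List.length_eq_zero_iff.1 hl.symm).symm hbc
  | cons i b ih =>
    rcases c with _ | ⟨j, c⟩
    · simp at hl
    by_cases hb : b = c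
    · subst hb
      cases i <;> cases j
      · exact absurd rfl hbc
      · exact hp.orth' b
      · exact hp.orth b
      · exact absurd rfl hbc
    · rw [← hp.mul_child i b, ← hp.mul_left_child j c, mul_assoc, ← mul_assoc (p b),
        ih (by simpa using hl) hb, zero_mul, mul_zero]

open Classical in
lemma mul_eq_ite {b c : List Bool} (hl : b.length ≤ c.length) :
    p c * p b = if b <:+ c then p c else 0 := by
  split_ifs with hbc
  · obtain ⟨l, rfl⟩ := hbc
    exact hp.mul_suffix l b
  · obtain ⟨l, c', rfl, hc'⟩ : ∃ l c', c = l ++ c' ∧ c'.length = b.length :=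
      ⟨c.take (c.length - b.length), c.drop (c.length - b.length), by simp, by simp; omega⟩
    rw [← hp.mul_suffix, mul_assoc, hp.mul_eq_zero hc' (fun he => hbc ⟨l, by rw [he]⟩), mul_zero]

open Classical in
lemma mul_eq_ite' {b c : List Bool} (hl : b.length ≤ c.length) :
    p b * p c = if b <:+ c then p c else 0 := by
  have := congrArg star (hp.mul_eq_ite hl)
  rw [star_mul, hp.star_eq, hp.star_eq] at this
  rw [this]
  split_ifs
  · exact hp.star_eq c
  · exact star_zero _

end IsProjTree

end Tree

section Blocks

variable {R : Type*} [Ring R] [StarRing R] [Algebra ℂ R] [StarModule ℂ R]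
variable {K : Type*} [NormedAddCommGroup K] [InnerProductSpace ℂ K] [CompleteSpace K]
variable {τ : R →ₗ[ℂ] ℂ} {π : R →⋆ₐ[ℂ] (K →L[ℂ] K)} {Ω : K} {A : StarSubalgebra ℂ R}
  {v : unitary R}

omit [CompleteSpace K] in
/-- Vectors that arise from each other by decreasing projections form a Cauchy sequence. -/
lemma cauchySeq_of_inner_eq {ξ : ℕ → K}
    (hξ : ∀ n m, n ≤ m → inner ℂ (ξ n) (ξ m) = ((‖ξ m‖ ^ 2 : ℝ) : ℂ)) : CauchySeq ξ := by
  have hd : ∀ n m, n ≤ m → ‖ξ n - ξ m‖ ^ 2 = ‖ξ n‖ ^ 2 - ‖ξ m‖ ^ 2 := by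
    intro n m hnm
    rw [@norm_sub_sq ℂ, hξ n m hnm]
    simp only [RCLike.re_to_complex, Complex.ofReal_re]
    ring
  have hanti : Antitone fun n => ‖ξ n‖ ^ 2 := antitone_nat_of_succ_le fun n => by
    have := hd n (n + 1) n.le_succ
    nlinarith [sq_nonneg ‖ξ n - ξ (n + 1)‖]
  have hconv := (tendsto_atTop_ciInf hanti ⟨0, by rintro _ ⟨n, rfl⟩; positivity⟩).cauchySeq
  rw [Metric.cauchySeq_iff'] at hconv ⊢
  intro ε hε
  obtain ⟨N, hN⟩ := hconv (ε ^ 2) (by positivity)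
  refine ⟨N, fun n hn => ?_⟩
  have h1 := hN n hn
  rw [Real.dist_eq, abs_sub_comm] at h1
  rw [dist_comm, dist_eq_norm]
  have h2 := (le_abs_self _).trans_lt h1
  rw [← hd N n hn] at h2
  exact lt_of_pow_lt_pow_left₀ 2 hε.le h2

lemma IsProjTree.norm_sum_sq {p : List Bool → R} (hp : IsProjTree A p) (n : ℕ)
    (η : List Bool → K) :
    ‖∑ b ∈ level n, π (p b) (η b)‖ ^ 2 = ∑ b ∈ level n, ‖π (p b) (η b)‖ ^ 2 := by
  have h1 : ((‖∑ b ∈ level n, π (p b) (η b)‖ ^ 2 : ℝ) : ℂ) =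
      ((∑ b ∈ level n, ‖π (p b) (η b)‖ ^ 2 : ℝ) : ℂ) := by
    push_cast
    have := inner_self_eq_norm_sq_to_K (𝕜 := ℂ) (∑ b ∈ level n, π (p b) (η b))
    refine this.symm.trans ?_
    rw [sum_inner]
    refine Finset.sum_congr rfl fun b hb => ?_
    rw [inner_sum, Finset.sum_eq_single b]
    · exact inner_self_eq_norm_sq_to_K _
    · intro c hc hcb
      rw [← ContinuousLinearMap.adjoint_inner_right, ← ContinuousLinearMap.star_eq_adjoint,
        ← map_star, hp.star_eq, ← mul_apply_eq_comp, ← map_mul,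
        hp.mul_eq_zero ((mem_level.1 hb).trans (mem_level.1 hc).symm) (Ne.symm hcb), map_zero,
        zero_apply, inner_zero_right]
    · exact fun h => absurd hb h
  exact_mod_cast h1

lemma IsProjTree.sum_norm_sq {p : List Bool → R} (hp : IsProjTree A p) (n : ℕ) (η : K) :
    ∑ b ∈ level n, ‖π (p b) η‖ ^ 2 = ‖π (p []) η‖ ^ 2 := by
  rw [← hp.norm_sum_sq, ← sum_apply, ← map_sum, hp.sum_level]

lemma IsTracialRep.mem_of_tendsto (h : IsTracialRep τ π Ω) (hA : IsCyclicMasa A v) {u : ℕ → R}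
    {y : R} (hu : ∀ n, u n ∈ A) (hy : Tendsto (fun n => π (u n) Ω) atTop (𝓝 (π y Ω))) : y ∈ A := by
  refine hA.masa y (h.ext (tendsto_nhds_unique (IsTracialRep.tendsto_mul_left hy v) ?_))
  refine (h.tendsto_mul_right hy v).congr fun n => ?_
  rw [(hA.comm _ (hu n) _ hA.mem).eq]

lemma IsTracialRep.tendsto_condExp (h : IsTracialRep τ π Ω) (hA : IsCyclicMasa A v) {u : ℕ → R}
    {y : R} (hy : Tendsto (fun n => π (u n) Ω) atTop (𝓝 (π y Ω)))
    (hu : ∀ n, condExp τ A (u n) = 0) : condExp τ A y = 0 := by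
  refine (h.condExp_eq_zero_iff hA).2 fun b hb => tendsto_nhds_unique (h.tendsto_trace_mul hy b) ?_
  simp only [((h.condExp_eq_zero_iff hA).1 (hu _)) b hb]
  exact tendsto_const_nhds

/-- The partial sums `∑ q_b x r_b` over the levels of two trees of projections converge in two-norm
to an element `y` that intertwines `r` and `q`. -/
lemma IsTracialRep.exists_block_limit (h : IsTracialRep τ π Ω) (hA : IsCyclicMasa A v)
    {q r : List Bool → R} (hq : IsProjTree A q) (hr : IsProjTree A r) (x : R) :
    ∃ y : R, Tendsto (fun n => π (∑ b ∈ level n, q b * x * r b) Ω) atTop (𝓝 (π y Ω)) ∧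
      (∀ b, y * r b = q b * y) ∧ (condExp τ A x = 0 → condExp τ A y = 0) ∧
      ∀ a ∈ A, ∀ s ∈ A, a * x = x * s → a * y = y * s := by
  classical
  set Y : ℕ → R := fun n => ∑ b ∈ level n, q b * x * r b with hY
  have hnorm : ∀ n, ‖π (Y n)‖ ≤ ‖π x‖ := fun n => by
    refine ContinuousLinearMap.opNorm_le_bound _ (norm_nonneg _) fun ζ => ?_
    refine le_of_sq_le_sq ?_ (by positivity)
    have e1 : π (Y n) ζ = ∑ b ∈ level n, π (q b) (π x (π (r b) ζ)) := by
      simp only [hY, map_sum, map_mul, sum_apply, mul_apply_eq_comp]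
    rw [e1, hq.norm_sum_sq n (fun b => π x (π (r b) ζ))]
    have hone : ∀ {p : List Bool → R}, IsProjTree A p → ∀ b (η : K), ‖π (p b) η‖ ≤ ‖η‖ :=
      fun {p} hp b η => by
        simpa using (π (p b)).le_of_opNorm_le
          (IsTracialRep.norm_proj_le (hp.star_eq b) (hp.mul_self b)) η
    calc ∑ b ∈ level n, ‖π (q b) (π x (π (r b) ζ))‖ ^ 2
        ≤ ∑ b ∈ level n, ‖π x‖ ^ 2 * ‖π (r b) ζ‖ ^ 2 := by
          refine Finset.sum_le_sum fun b _ => ?_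
          rw [← mul_pow]
          gcongr
          exact (hone hq b _).trans ((π x).le_opNorm _)
      _ = ‖π x‖ ^ 2 * ‖π (r []) ζ‖ ^ 2 := by rw [← Finset.mul_sum, hr.sum_norm_sq]
      _ ≤ (‖π x‖ * ‖ζ‖) ^ 2 := by
          rw [mul_pow]
          gcongr
          exact hone hr [] ζ
  have hqY : ∀ n m, n ≤ m → ∀ c ∈ level m, q c * Y n * r c = q c * x * r c := by
    intro n m hnm c hc
    rw [mem_level] at hc
    have hterm : ∀ b ∈ level n, q c * (q b * x * r b) * r c =
        if b = c.drop (m - n) then q c * x * r c else 0 := by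
      intro b hb
      rw [mem_level] at hb
      have hbc : b <:+ c ↔ b = c.drop (m - n) := by
        rw [List.suffix_iff_eq_drop, hc, hb]
      calc q c * (q b * x * r b) * r c = (q c * q b) * x * (r b * r c) := by noncomm_ring
        _ = _ := by
          rw [hq.mul_eq_ite (by omega), hr.mul_eq_ite' (by omega)]
          simp only [hbc]
          split_ifs <;> simp
    rw [hY]
    simp only [Finset.mul_sum, Finset.sum_mul]
    rw [Finset.sum_congr rfl hterm, Finset.sum_ite_eq', if_pos]
    rw [mem_level, List.length_drop]
    omega
  have hYs : ∀ n m, n ≤ m → τ (star (Y n) * Y m) =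
      ∑ c ∈ level m, τ (star (q c * x * r c) * x) := by
    intro n m hnm
    rw [show Y m = ∑ c ∈ level m, q c * x * r c from rfl, Finset.mul_sum, map_sum]
    refine Finset.sum_congr rfl fun c hc => ?_
    have e1 : star (q c * Y n * r c) * x = r c * (star (Y n) * (q c * x)) := by
      rw [star_mul, star_mul, hq.star_eq, hr.star_eq]; noncomm_ring
    rw [← hqY n m hnm c hc, e1, h.tracial (r c), hqY n m hnm c hc,
      mul_assoc (star (Y n))]
  have hcau : CauchySeq fun n => π (Y n) Ω := cauchySeq_of_inner_eq fun n m hnm => by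
    rw [h.inner_eq, hYs n m hnm, ← hYs m m le_rfl, h.trace_star_mul_self]
  obtain ⟨ξ, hξ⟩ := cauchySeq_tendsto_of_complete hcau
  obtain ⟨y, -, rfl⟩ := h.complete ‖π x‖ Y ξ hnorm hξ
  refine ⟨y, hξ, fun b => h.ext ?_, fun hx => h.tendsto_condExp hA hξ fun n => ?_,
    fun a ha s hs hax => h.ext ?_⟩
  · refine tendsto_nhds_unique (h.tendsto_mul_right hξ (r b)) ?_
    refine (IsTracialRep.tendsto_mul_left hξ (q b)).congr' ?_
    filter_upwards [eventually_ge_atTop b.length] with n hn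
    congr 2
    rw [hY]
    simp only [Finset.mul_sum, Finset.sum_mul]
    refine Finset.sum_congr rfl fun c hc => ?_
    rw [mem_level] at hc
    calc q b * (q c * x * r c) = (q b * q c) * x * r c := by noncomm_ring
      _ = q c * x * (r c * r b) := by
        rw [hq.mul_eq_ite' (by omega), hr.mul_eq_ite (by omega)]
        split_ifs <;> simp
      _ = q c * x * r c * r b := by rw [mul_assoc _ (r c)]
  · rw [hY]
    simp only
    rw [h.condExp_sum hA]
    refine Finset.sum_eq_zero fun b _ => ?_
    rw [h.condExp_mul_right hA (hr.mem b), h.condExp_mul_left hA (hq.mem b), hx, mul_zero, zero_mul]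
  · refine tendsto_nhds_unique (IsTracialRep.tendsto_mul_left hξ a) ?_
    refine (h.tendsto_mul_right hξ s).congr fun n => ?_
    congr 2
    rw [hY]
    simp only [Finset.mul_sum, Finset.sum_mul]
    refine Finset.sum_congr rfl fun c _ => ?_
    calc q c * x * r c * s = q c * (x * s) * r c := by
          rw [mul_assoc _ (r c), (hA.comm _ (hr.mem c) _ hs).eq]; noncomm_ring
      _ = q c * a * x * r c := by rw [← hax]; noncomm_ring
      _ = a * (q c * x * r c) := by rw [(hA.comm _ (hq.mem c) _ ha).eq]; noncomm_ring

end Blocks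

/-! ### Selecting atoms -/

/-- The join of the projections `p (l ++ b)` over all words `l` of length `m`, for a family of
commuting projections `p`: the part of the unit on which some descendant of `b` of relative depth
`m` is selected by `p`. -/
def aliveProj {R : Type*} [Ring R] (p : List Bool → R) : ℕ → List Bool → R
  | 0, b => p b
  | m + 1, b => aliveProj p m (true :: b) + aliveProj p m (false :: b) -
      aliveProj p m (true :: b) * aliveProj p m (false :: b)

lemma mul_aliveProj {R : Type*} [Ring R] {p : List Bool → R} (hp2 : ∀ b, p b * p b = p b)
    (hcomm : ∀ m b b', Commute (p b) (aliveProj p m b')) (l b : List Bool) :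
    p (l ++ b) * aliveProj p l.length b = p (l ++ b) := by
  induction l using List.reverseRecOn generalizing b with
  | nil => exact hp2 b
  | append_singleton l c ih =>
    have h1 := ih (c :: b)
    rw [List.length_append, List.length_singleton, List.append_assoc, List.singleton_append]
    set P := p (l ++ c :: b) with hP
    have h2 := (hcomm l.length (l ++ c :: b) (true :: b)).eq
    simp only [aliveProj]
    rw [← hP] at h2
    cases c
    · rw [mul_sub, mul_add, ← mul_assoc, h2, mul_assoc, h1, ← h2, add_sub_cancel_left]
    · rw [mul_sub, mul_add, ← mul_assoc, h1, add_sub_cancel_right]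

section Atoms

variable {R : Type*} [Ring R] [StarRing R] [Algebra ℂ R] [StarModule ℂ R]
variable {K : Type*} [NormedAddCommGroup K] [InnerProductSpace ℂ K] [CompleteSpace K]
variable {τ : R →ₗ[ℂ] ℂ} {π : R →⋆ₐ[ℂ] (K →L[ℂ] K)} {Ω : K} {A : StarSubalgebra ℂ R}
  {v : unitary R}

lemma IsCyclicMasa.aliveProj_spec (hA : IsCyclicMasa A v) {p : List Bool → R}
    (hp : ∀ b, p b ∈ A ∧ star (p b) = p b ∧ p b * p b = p b) (m : ℕ) (b : List Bool) :
    aliveProj p m b ∈ A ∧ star (aliveProj p m b) = aliveProj p m b ∧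
      aliveProj p m b * aliveProj p m b = aliveProj p m b := by
  induction m generalizing b with
  | zero => exact hp b
  | succ m ih =>
    obtain ⟨h1, h2, h3⟩ := ih (true :: b)
    obtain ⟨k1, k2, k3⟩ := ih (false :: b)
    simp only [aliveProj]
    refine ⟨sub_mem (add_mem h1 k1) (mul_mem h1 k1), ?_, ?_⟩
    · rw [star_sub, star_add, star_mul, h2, k2, (hA.comm _ h1 _ k1).eq]
    · let _ := hA.commRing
      have key : ∀ a b : A, a * a = a → b * b = b →
          (a + b - a * b) * (a + b - a * b) = a + b - a * b := by
        intro a b ha hb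
        linear_combination (1 - 2 * b + b * b) * ha + (1 - a) * hb
      exact congrArg Subtype.val (key ⟨_, h1⟩ ⟨_, k1⟩ (Subtype.ext h3) (Subtype.ext k3))

lemma IsCyclicMasa.aliveProj_succ_mul (hA : IsCyclicMasa A v) {p : List Bool → R}
    (hp : ∀ b, p b ∈ A ∧ star (p b) = p b ∧ p b * p b = p b)
    (hmono : ∀ c b, p (c :: b) * p b = p (c :: b)) (m : ℕ) (b : List Bool) :
    aliveProj p (m + 1) b * aliveProj p m b = aliveProj p (m + 1) b := by
  induction m generalizing b with
  | zero =>
    simp only [aliveProj]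
    rw [sub_mul, add_mul, mul_assoc, hmono, hmono]
  | succ m ih =>
    let _ := hA.commRing
    have key : ∀ a b a' b' : A, a * a' = a → b * b' = b →
        (a + b - a * b) * (a' + b' - a' * b') = a + b - a * b := by
      intro a b a' b' ha hb
      linear_combination (1 - b' - b + b * b') * ha + (1 - a') * hb
    have := congrArg Subtype.val (key ⟨_, (hA.aliveProj_spec hp (m + 1) (true :: b)).1⟩
      ⟨_, (hA.aliveProj_spec hp (m + 1) (false :: b)).1⟩
      ⟨_, (hA.aliveProj_spec hp m (true :: b)).1⟩ ⟨_, (hA.aliveProj_spec hp m (false :: b)).1⟩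
      (Subtype.ext (ih _)) (Subtype.ext (ih _)))
    exact this

namespace IsTracialRep

variable (h : IsTracialRep τ π Ω) (hA : IsCyclicMasa A v)
include h hA

/-- A decreasing sequence of projections in `A` converges. -/
lemma exists_decreasing_limit {u : ℕ → R}
    (hu : ∀ n, u n ∈ A ∧ star (u n) = u n ∧ u n * u n = u n)
    (hdec : ∀ n, u (n + 1) * u n = u (n + 1)) :
    ∃ P, (P ∈ A ∧ star P = P ∧ P * P = P) ∧ Tendsto (fun n => π (u n) Ω) atTop (𝓝 (π P Ω)) := by
  have hle : ∀ n m, n ≤ m → u m * u n = u m := by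
    intro n m hnm
    induction m, hnm using Nat.le_induction with
    | base => exact (hu n).2.2
    | succ m _ ih => rw [← hdec m, mul_assoc, ih]
  have hn : ∀ n, ‖π (u n)‖ ≤ 1 := fun n => norm_proj_le (hu n).2.1 (hu n).2.2
  have hcau : CauchySeq fun n => π (u n) Ω := cauchySeq_of_inner_eq fun n m hnm => by
    rw [h.inner_eq, ← h.trace_star_mul_self, (hu n).2.1, (hu m).2.1, (hu m).2.2,
      (hA.comm _ (hu n).1 _ (hu m).1).eq, hle n m hnm]
  obtain ⟨ξ, hξ⟩ := cauchySeq_tendsto_of_complete hcau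
  obtain ⟨P, -, rfl⟩ := h.complete 1 u ξ hn hξ
  refine ⟨P, ⟨h.mem_of_tendsto hA (fun n => (hu n).1) hξ, h.ext ?_, h.ext ?_⟩, hξ⟩
  · exact tendsto_nhds_unique ((h.tendsto_star hξ).congr fun n => by rw [(hu n).2.1]) hξ
  · exact tendsto_nhds_unique ((h.tendsto_mul hn hξ hξ).congr fun n => by rw [(hu n).2.2]) hξ

/-- Pairing of a positive element of `A` with `E_A(x r x*)`, where `r` is a projection. -/
lemma trace_condExp_conj {r a : R} (hrs : star r = r) (hr2 : r * r = r) (ha : a ∈ A) (x : R) :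
    τ (condExp τ A (x * r * star x) * (a * star a)) =
      ((‖π (r * (star x * a)) Ω‖ ^ 2 : ℝ) : ℂ) := by
  rw [h.trace_condExp_mul hA (mul_mem ha (star_mem ha)), ← h.trace_star_mul_self, star_mul,
    star_mul, star_star, hrs, ← mul_assoc, h.tracial _ (star a)]
  congr 1
  calc star a * (x * r * star x * a) = star a * x * r * (star x * a) := by noncomm_ring
    _ = star a * x * (r * r) * (star x * a) := by rw [hr2]
    _ = _ := by noncomm_ring

/-- If `∑ ‖E_A(x r_b x*)‖₂²` over the levels of a tree of projections is bounded below, there is a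
nonzero `y` with `y r_b = q_b y` for projections `q_b` in `A`.

Write `g_b = E_A(x r_b x*)` and `p_b` for the spectral projection of `g_b` for `(c', ∞)`. Over the
spectrum of `A`, the `g_b` form a measure on the boundary of the tree which has an atom of mass at
least `c'` at the points below infinitely long branches along which `p_b` is alive. The tree `q`
selects one such branch, always preferring the child `true :: b`, and `y` is the limit of
`∑ q_b x r_b`. -/
lemma exists_intertwiner {r : List Bool → R} (hr : IsProjTree A r) (hr1 : r [] = 1) (x : R) {c : ℝ}
    (hc : 0 < c)
    (hx : ∀ n, c ≤ ∑ b ∈ level n, ‖π (condExp τ A (x * r b * star x)) Ω‖ ^ 2) :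
    ∃ (y : R) (q : List Bool → R), y ≠ 0 ∧ (∀ b, q b ∈ A ∧ star (q b) = q b) ∧
      (∀ b, y * r b = q b * y) ∧ (condExp τ A x = 0 → condExp τ A y = 0) ∧
      ∀ a ∈ A, ∀ s ∈ A, a * x = x * s → a * y = y * s := by
  set B : ℝ := ‖π x‖ ^ 2 + 1 with hB
  have hB0 : 0 < B := by positivity
  set c' : ℝ := c / (2 * B) with hc'
  have hc'0 : 0 < c' := by positivity
  set g : List Bool → R := fun b => condExp τ A (x * r b * star x) with hg
  have hgA : ∀ b, g b ∈ A := fun b => h.condExp_mem hA _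
  have hgs : ∀ b, star (g b) = g b := fun b => by
    rw [hg]; simp only
    rw [← h.condExp_star hA, star_mul, star_mul, star_star, hr.star_eq, mul_assoc]
  have hcs : star ((c' : ℂ) • (1 : R)) = (c' : ℂ) • 1 := by simp
  have hgadd : ∀ b, g (true :: b) + g (false :: b) = g b := fun b => by
    simp only [hg]
    rw [← h.condExp_add hA, ← add_mul, ← mul_add, hr.add_children]
  have hsign := fun b => h.sign (g b - (c' : ℂ) • 1) (by rw [star_sub, hgs, hcs])
  choose p s t hps hp2 hss hts hge hgf hsupp hcomm using hsign
  have hgv : ∀ b, Commute (g b - (c' : ℂ) • 1) v := fun b =>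
    hA.comm _ (sub_mem (hgA b) (A.smul_mem (one_mem _) _)) _ hA.mem
  have hpA : ∀ b, p b ∈ A := fun b => hA.masa _ (hcomm b _ (hgv b)).1.symm
  have hsA : ∀ b, s b ∈ A := fun b => hA.masa _ (hcomm b _ (hgv b)).2.1.symm
  have htA : ∀ b, t b ∈ A := fun b => hA.masa _ (hcomm b _ (hgv b)).2.2.symm
  have hp : ∀ b, p b ∈ A ∧ star (p b) = p b ∧ p b * p b = p b := fun b => ⟨hpA b, hps b, hp2 b⟩
  have hgtr : ∀ b a, a ∈ A → τ (g b * (a * star a)) =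
      ((‖π (r b * (star x * a)) Ω‖ ^ 2 : ℝ) : ℂ) := fun b a ha =>
    h.trace_condExp_conj hA (hr.star_eq b) (hr.mul_self b) ha x
  -- the spectral projections decrease along the tree, since `g` does
  have hmono : ∀ i b, p (i :: b) * p b = p (i :: b) := by
    intro i b
    obtain ⟨j, hj⟩ : ∃ j, g (i :: b) + g (j :: b) = g b := by
      cases i
      · exact ⟨true, by rw [add_comm]; exact hgadd b⟩
      · exact ⟨false, hgadd b⟩
    set f := p (i :: b) * (1 - p b) with hf
    have hfA : f ∈ A := mul_mem (hpA _) (sub_mem (one_mem _) (hpA _))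
    let _ := hA.commRing
    have hff : f * f = f ∧ p (i :: b) * f = f ∧ (1 - p b) * f = f := by
      have key : ∀ a b : A, a * a = a → b * b = b → a * (1 - b) * (a * (1 - b)) = a * (1 - b) ∧
          a * (a * (1 - b)) = a * (1 - b) ∧ (1 - b) * (a * (1 - b)) = a * (1 - b) := by
        intro a b ha hb
        refine ⟨?_, ?_, ?_⟩
        · linear_combination (1 - b) ^ 2 * ha + a * hb
        · linear_combination (1 - b) * ha
        · linear_combination a * hb
      obtain ⟨k1, k2, k3⟩ := key ⟨_, hpA (i :: b)⟩ ⟨_, hpA b⟩ (Subtype.ext (hp2 _))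
        (Subtype.ext (hp2 _))
      exact ⟨congrArg Subtype.val k1, congrArg Subtype.val k2, congrArg Subtype.val k3⟩
    obtain ⟨hf2, hfp, hfq⟩ := hff
    have hfs : star f = f := by
      rw [hf, star_mul, star_sub, star_one, hps, hps,
        (hA.comm _ (hpA _) _ (sub_mem (one_mem _) (hpA b))).eq]
    have e1 : (g (i :: b) - (c' : ℂ) • 1) * f = star (s (i :: b) * f) * (s (i :: b) * f) := by
      rw [star_mul, hss, hfs]
      calc (g (i :: b) - (c' : ℂ) • 1) * f = (g (i :: b) - (c' : ℂ) • 1) * p (i :: b) * f := by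
            rw [mul_assoc, hfp]
        _ = s (i :: b) * s (i :: b) * f := by rw [hge]
        _ = s (i :: b) * s (i :: b) * (f * f) := by rw [hf2]
        _ = f * (s (i :: b) * s (i :: b)) * f := by
            rw [(hA.comm _ hfA _ (mul_mem (hsA (i :: b)) (hsA (i :: b)))).eq]; noncomm_ring
        _ = _ := by noncomm_ring
    have e2 : (g b - (c' : ℂ) • 1) * f = -(star (t b * f) * (t b * f)) := by
      rw [star_mul, hts, hfs]
      calc (g b - (c' : ℂ) • 1) * f = (g b - (c' : ℂ) • 1) * (1 - p b) * f := by
            rw [mul_assoc, hfq]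
        _ = -(t b * t b) * (f * f) := by rw [hgf, hf2]
        _ = -(f * (t b * t b) * f) := by
            rw [(hA.comm _ hfA _ (mul_mem (htA b) (htA b))).eq]; noncomm_ring
        _ = _ := by noncomm_ring
    have e3 : g (j :: b) * (f * star f) =
        (g b - (c' : ℂ) • 1) * f - (g (i :: b) - (c' : ℂ) • 1) * f := by
      rw [hfs, hf2, ← hj]; noncomm_ring
    have e4 := congrArg τ e3
    rw [hgtr _ _ hfA, e1, e2, map_sub, map_neg, h.trace_star_mul_self, h.trace_star_mul_self] at e4
    have e5 : ‖π (r (j :: b) * (star x * f)) Ω‖ ^ 2 =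
        -‖π (t b * f) Ω‖ ^ 2 - ‖π (s (i :: b) * f) Ω‖ ^ 2 := by exact_mod_cast e4
    have e6 : ‖π (s (i :: b) * f) Ω‖ = 0 := by
      nlinarith [sq_nonneg ‖π (r (j :: b) * (star x * f)) Ω‖, sq_nonneg ‖π (t b * f) Ω‖,
        sq_nonneg ‖π (s (i :: b) * f) Ω‖]
    have e7 : p (i :: b) * f = 0 := hsupp _ _ (h.faithful _ (norm_eq_zero.1 e6))
    rw [hfp, hf, mul_sub, mul_one, sub_eq_zero] at e7
    exact e7.symm
  have hq := hA.aliveProj_spec hp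
  choose P hP hPlim using fun b => h.exists_decreasing_limit hA (u := fun m => aliveProj p m b)
    (fun m => hq m b) (fun m => hA.aliveProj_succ_mul hp hmono m b)
  have hPjoin : ∀ b, P b = P (true :: b) + P (false :: b) - P (true :: b) * P (false :: b) := by
    intro b
    refine h.ext (tendsto_nhds_unique ((hPlim b).comp (tendsto_add_atTop_nat 1)) ?_)
    have h1 := ((hPlim (true :: b)).add (hPlim (false :: b))).sub
      (h.tendsto_mul (fun n => norm_proj_le (hq n _).2.1 (hq n _).2.2) (hPlim (true :: b))
        (hPlim (false :: b)))
    have h2 : π (P (true :: b) + P (false :: b) - P (true :: b) * P (false :: b)) Ω =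
        π (P (true :: b)) Ω + π (P (false :: b)) Ω - π (P (true :: b) * P (false :: b)) Ω := by
      rw [map_sub, map_add, sub_apply, add_apply]
    rw [h2]
    refine h1.congr fun n => ?_
    simp only [Function.comp_apply, aliveProj]
    rw [map_sub, map_add, sub_apply, add_apply]
  have hPp : ∀ b, P b * p b = P b := by
    intro b
    refine h.ext (tendsto_nhds_unique (h.tendsto_mul_right (hPlim b) (p b)) ?_)
    refine (hPlim b).congr fun m => ?_
    congr 2
    induction m with
    | zero => exact (hp2 b).symm
    | succ m ih => rw [← hA.aliveProj_succ_mul hp hmono m b, mul_assoc, ← ih]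
  -- the lower bound for the root
  have hroot : ∀ n, c / 2 ≤ B ^ 2 * ‖π (aliveProj p n []) Ω‖ ^ 2 := by
    intro n
    set Z := aliveProj p n [] with hZ
    obtain ⟨hZA, hZs, hZ2⟩ := hq n []
    have hWA : 1 - Z ∈ A := sub_mem (one_mem _) hZA
    have hWs : star (1 - Z) = 1 - Z := by rw [star_sub, star_one, hZs]
    have hW2 : (1 - Z) * (1 - Z) = 1 - Z := by
      rw [mul_sub, mul_one, sub_mul, one_mul, hZ2, sub_self, sub_zero]
    have hpZ : ∀ b ∈ level n, p b * Z = p b := fun b hb => by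
      have := mul_aliveProj hp2 (fun m b b' => hA.comm _ (hpA b) _ (hq m b').1) b []
      rwa [List.append_nil, mem_level.1 hb] at this
    have hterm : ∀ b ∈ level n, ‖π (g b) Ω‖ ^ 2 ≤
        B * ‖π (r b * (star x * Z)) Ω‖ ^ 2 + c' * ‖π (r b * (star x * (1 - Z))) Ω‖ ^ 2 := by
      intro b hb
      have hsplit : τ (star (g b) * g b) = τ (g b * (g b * Z)) + τ (g b * (g b * (1 - Z))) := by
        rw [← map_add, ← mul_add, ← mul_add, add_sub_cancel, mul_one, hgs]
      -- on `Z`, the operator norm bounds one factor `g b`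
      have h1 : ‖τ (g b * (g b * Z))‖ ≤ B * ‖π (r b * (star x * Z)) Ω‖ ^ 2 := by
        have e1 : τ (g b * (g b * Z)) = τ (star (Z * x * r b) * (g b * (Z * x * r b))) := by
          conv_lhs => rw [hg]
          rw [h.trace_condExp_mul hA (mul_mem (hgA b) hZA)]
          rw [star_mul, star_mul, hr.star_eq, hZs]
          have k1 : g b * Z = Z * (g b * Z) := by
            rw [← mul_assoc, (hA.comm _ hZA _ (hgA b)).eq, mul_assoc, hZ2]
          have k2 : x * r b * star x * (Z * (g b * Z)) =
              x * r b * (r b * (star x * (Z * (g b * Z)))) := by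
            rw [show x * r b * (r b * (star x * (Z * (g b * Z)))) =
              x * (r b * r b) * star x * (Z * (g b * Z)) by noncomm_ring, hr.mul_self]
          conv_lhs => rw [k1, k2, h.tracial]
          congr 1
          noncomm_ring
        have e2 : ‖π (Z * x * r b) Ω‖ = ‖π (r b * (star x * Z)) Ω‖ := by
          rw [← h.norm_star, star_mul, star_mul, hr.star_eq, hZs]
        have e3 : ‖π (g b)‖ ≤ B := by
          refine (h.norm_condExp_le hA _).trans ?_
          rw [map_mul, map_mul]
          calc ‖π x * π (r b) * π (star x)‖ ≤ ‖π x‖ * ‖π (r b)‖ * ‖π (star x)‖ :=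
                (norm_mul_le _ _).trans (by gcongr; exact norm_mul_le _ _)
            _ ≤ ‖π x‖ * 1 * ‖π x‖ := by
                rw [norm_rep_star]
                gcongr
                exact norm_proj_le (hr.star_eq b) (hr.mul_self b)
            _ ≤ B := by rw [hB]; nlinarith
        rw [e1, ← e2]
        refine (h.norm_trace_le _ _).trans ?_
        calc ‖π (Z * x * r b) Ω‖ * ‖π (g b * (Z * x * r b)) Ω‖
            ≤ ‖π (Z * x * r b) Ω‖ * (B * ‖π (Z * x * r b) Ω‖) := by
              gcongr
              exact (norm_mul_left _ _).trans (by gcongr)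
          _ = _ := by ring
      -- off `Z`, `g b ≤ c'`
      have h2 : (τ (g b * (g b * (1 - Z)))).re ≤ c' * ‖π (r b * (star x * (1 - Z))) Ω‖ ^ 2 := by
        have k0 : (1 - p b) * (1 - Z) = 1 - Z := by
          rw [sub_mul, one_mul, mul_sub, mul_one, hpZ b hb, sub_self, sub_zero]
        have k1 : g b * (1 - Z) = (c' : ℂ) • ((1 - Z) * star (1 - Z))
            - (t b * (1 - Z)) * star (t b * (1 - Z)) := by
          rw [star_mul, hWs, hts]
          calc g b * (1 - Z) = (c' : ℂ) • (1 - Z) + (g b - (c' : ℂ) • 1) * (1 - p b) * (1 - Z) := by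
                rw [mul_assoc, k0, sub_mul, smul_mul_assoc, one_mul]; abel
            _ = (c' : ℂ) • (1 - Z) - t b * (t b * (1 - Z)) := by
                rw [hgf]; noncomm_ring
            _ = (c' : ℂ) • ((1 - Z) * (1 - Z)) - t b * ((1 - Z) * t b) := by
                rw [(hA.comm _ hWA _ (htA b)).eq, hW2]
            _ = _ := by
                rw [mul_assoc (t b), ← mul_assoc (1 - Z) (1 - Z) (t b), hW2]
        rw [k1, mul_sub, mul_smul_comm, map_sub, map_smul, hgtr b _ hWA,
          hgtr b _ (mul_mem (htA b) hWA), smul_eq_mul, ← Complex.ofReal_mul, ← Complex.ofReal_sub,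
          Complex.ofReal_re]
        linarith [sq_nonneg ‖π (r b * (star x * (t b * (1 - Z)))) Ω‖]
      have h3 := congrArg Complex.re hsplit
      rw [h.trace_star_mul_self, Complex.ofReal_re, Complex.add_re] at h3
      rw [h3]
      exact add_le_add ((Complex.re_le_norm _).trans h1) h2
    have hsum : ∀ a : R, ∑ b ∈ level n, ‖π (r b * a) Ω‖ ^ 2 = ‖π a Ω‖ ^ 2 := fun a => by
      simp only [map_mul, mul_apply_eq_comp]
      rw [hr.sum_norm_sq, hr1, map_one]
      rfl
    have hxa : ∀ a : R, ‖π (star x * a) Ω‖ ^ 2 ≤ B * ‖π a Ω‖ ^ 2 := fun a => by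
      have := norm_mul_left (π := π) (Ω := Ω) (star x) a
      rw [norm_rep_star] at this
      calc ‖π (star x * a) Ω‖ ^ 2 ≤ (‖π x‖ * ‖π a Ω‖) ^ 2 := by gcongr
        _ ≤ B * ‖π a Ω‖ ^ 2 := by rw [mul_pow]; gcongr; rw [hB]; linarith
    have hW1 : ‖π (1 - Z) Ω‖ ^ 2 ≤ 1 := by
      have k1 := (norm_mul_left (π := π) (Ω := Ω) (1 - Z) 1).trans
        (mul_le_mul_of_nonneg_right (norm_proj_le (π := π) hWs hW2) (norm_nonneg _))
      have k2 := h.trace_star_mul_self 1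
      rw [star_one, mul_one, h.trace_one] at k2
      have k3 : ‖π 1 Ω‖ ^ 2 = 1 := by exact_mod_cast k2.symm
      rw [mul_one, one_mul] at k1
      rw [← k3]
      gcongr
    have h4 := (hx n).trans (Finset.sum_le_sum hterm)
    rw [Finset.sum_add_distrib, ← Finset.mul_sum, ← Finset.mul_sum, hsum, hsum] at h4
    have h5 : c' * ‖π (star x * (1 - Z)) Ω‖ ^ 2 ≤ c / 2 := by
      calc c' * ‖π (star x * (1 - Z)) Ω‖ ^ 2 ≤ c' * (B * 1) := by
            gcongr
            exact (hxa _).trans (by gcongr)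
        _ = c / 2 := by rw [hc']; field_simp
    have h6 : B * ‖π (star x * Z) Ω‖ ^ 2 ≤ B ^ 2 * ‖π Z Ω‖ ^ 2 := by
      calc B * ‖π (star x * Z) Ω‖ ^ 2 ≤ B * (B * ‖π Z Ω‖ ^ 2) := by gcongr; exact hxa _
        _ = _ := by ring
    linarith
  have hroot' : c / 2 ≤ B ^ 2 * ‖π (P []) Ω‖ ^ 2 :=
    ge_of_tendsto (((hPlim []).norm.pow 2).const_mul (B ^ 2)) (Eventually.of_forall hroot)
  -- the selected branch
  set q : List Bool → R := projTree (P []) (fun b => P (true :: b)) with hqdef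
  have hqt : IsProjTree A q := isProjTree_projTree hA (hP []) (fun b => hP _)
  have hqP : ∀ b, q b * P b = q b := by
    intro b
    induction b with
    | nil => exact (hP []).2.2
    | cons i b ih =>
      cases i
      · have k1 : (1 - P (true :: b)) * P (false :: b) = P b * (1 - P (true :: b)) := by
          have k2 := (hP (true :: b)).2.2
          have k3 := (hA.comm _ (hP (true :: b)).1 _ (hP (false :: b)).1).eq
          have k4 : P (true :: b) * P (false :: b) * P (true :: b) =
              P (true :: b) * P (false :: b) := by
            rw [mul_assoc, ← k3, ← mul_assoc, k2]
          rw [hPjoin b, mul_sub, mul_one, sub_mul, sub_mul, add_mul, k4, k2, one_mul, ← k3]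
          abel
        change q b * (1 - P (true :: b)) * P (false :: b) = q b * (1 - P (true :: b))
        rw [mul_assoc, k1, ← mul_assoc, ih]
      · change q b * P (true :: b) * P (true :: b) = q b * P (true :: b)
        rw [mul_assoc, (hP _).2.2]
  have hqp : ∀ b, q b * p b = q b := fun b => by
    rw [← hqP b, mul_assoc, hPp]
  obtain ⟨y, hylim, hyr, hy0, hyc⟩ := h.exists_block_limit hA hqt hr x
  refine ⟨y, q, ?_, fun b => ⟨hqt.mem b, hqt.star_eq b⟩, hyr, hy0, hyc⟩
  -- `‖∑ q_b x r_b‖₂² = ∑ τ(q_b g_b) ≥ c' τ(q_[])`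
  have hlow : ∀ n, c' * ‖π (P []) Ω‖ ^ 2 ≤ ‖π (∑ b ∈ level n, q b * x * r b) Ω‖ ^ 2 := by
    intro n
    have k1 : π (∑ b ∈ level n, q b * x * r b) Ω =
        ∑ b ∈ level n, π (q b) (π (x * r b) Ω) := by
      simp only [map_sum, sum_apply, mul_assoc, map_mul, mul_apply_eq_comp]
    have k2 : ∑ b ∈ level n, ‖π (q b) Ω‖ ^ 2 = ‖π (P []) Ω‖ ^ 2 := hqt.sum_norm_sq n Ω
    rw [k1, hqt.norm_sum_sq n (fun b => π (x * r b) Ω), ← k2, Finset.mul_sum]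
    refine Finset.sum_le_sum fun b _ => ?_
    rw [← mul_apply_eq_comp, ← map_mul, ← h.norm_star (q b * (x * r b)), star_mul, star_mul,
      hr.star_eq, hqt.star_eq, mul_assoc]
    have k3 := hgtr b (q b) (hqt.mem b)
    have k4 : g b * (q b * star (q b)) =
        (c' : ℂ) • (star (q b) * q b) + star (s b * q b) * (s b * q b) := by
      rw [star_mul, hss, hqt.star_eq, hqt.mul_self]
      have k5 : q b * s b * (s b * q b) = s b * s b * q b := by
        rw [← mul_assoc, mul_assoc (q b), (hA.comm _ (hqt.mem b) _ (mul_mem (hsA b) (hsA b))).eq,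
          mul_assoc, hqt.mul_self]
      rw [k5, ← hge, mul_assoc, (hA.comm _ (hpA b) _ (hqt.mem b)).eq, hqp, sub_mul, smul_mul_assoc,
        one_mul]
      abel
    rw [k4, map_add, map_smul, h.trace_star_mul_self, h.trace_star_mul_self, smul_eq_mul] at k3
    have k6 : c' * ‖π (q b) Ω‖ ^ 2 + ‖π (s b * q b) Ω‖ ^ 2 =
        ‖π (r b * (star x * q b)) Ω‖ ^ 2 := by exact_mod_cast k3
    rw [← k6]
    linarith [sq_nonneg ‖π (s b * q b) Ω‖]
  have hylow : c' * ‖π (P []) Ω‖ ^ 2 ≤ ‖π y Ω‖ ^ 2 :=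
    ge_of_tendsto (hylim.norm.pow 2) (Eventually.of_forall hlow)
  rintro rfl
  rw [map_zero, zero_apply, norm_zero, zero_pow two_ne_zero] at hylow
  have k1 : ‖π (P []) Ω‖ ^ 2 ≤ 0 := by
    by_contra hcon
    exact absurd hylow (not_le.2 (mul_pos hc'0 (not_le.1 hcon)))
  nlinarith [mul_nonneg (sq_nonneg B) (neg_nonneg.2 k1)]

end IsTracialRep

end Atoms

/-! ### Intertwiners and normalizing unitaries -/

section Normalizer

variable {R : Type*} [Ring R] [StarRing R] [Algebra ℂ R] [StarModule ℂ R]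
variable {K : Type*} [NormedAddCommGroup K] [InnerProductSpace ℂ K] [CompleteSpace K]
variable {τ : R →ₗ[ℂ] ℂ} {π : R →⋆ₐ[ℂ] (K →L[ℂ] K)} {Ω : K} {A : StarSubalgebra ℂ R}
  {v : unitary R}

/-- Let `w₀` be a partial isometry with orthogonal initial and final projections in `A`, and suppose
that conjugation by `w₀` and by `w₀*` maps `A` into `A`. If `A` is singular, then `w₀ = 0`, since
`w₀ + w₀* + (1 - w₀* w₀ - w₀ w₀*)` is a normalizing unitary. -/
lemma eq_zero_of_orthogonal (hA : IsCyclicMasa A v) (hsing : IsSingular A) {w : R}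
    (hw : w * (star w * w) = w) (hor : star w * w * (w * star w) = 0)
    (h1 : ∀ a ∈ A, w * a * star w ∈ A) (h2 : ∀ a ∈ A, star w * a * w ∈ A) : w = 0 := by
  set r := star w * w with hr
  set r' := w * star w with hr'
  have hrA : r ∈ A := by simpa using h2 1 (one_mem _)
  have hrA' : r' ∈ A := by simpa using h1 1 (one_mem _)
  have hor' : r' * r = 0 := by rw [(hA.comm _ hrA' _ hrA).eq, hor]
  have hrs : star r = r := by rw [hr, star_mul, star_star]
  have hrs' : star r' = r' := by rw [hr', star_mul, star_star]
  have hw' : r' * w = w := by rw [hr', mul_assoc, ← hr, hw]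
  have hws : r * star w = star w := by rw [← hrs, ← star_mul, hw]
  have hws' : star w * r' = star w := by rw [← hrs', ← star_mul, hw']
  have hwr' : w * r' = 0 := by rw [← hw, mul_assoc, hor, mul_zero]
  have hrw : r * w = 0 := by rw [← hw', ← mul_assoc, hor, zero_mul]
  have hswr : star w * r = 0 := by rw [← hws', mul_assoc, hor', mul_zero]
  have hr'sw : r' * star w = 0 := by rw [← hws, ← mul_assoc, hor', zero_mul]
  have hww : w * w = 0 := by
    calc w * w = w * r' * w := by rw [mul_assoc, hw']
      _ = 0 := by rw [hwr', zero_mul]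
  have hwws : star w * star w = 0 := by rw [← star_mul, hww, star_zero]
  have hr2 : r * r = r := by
    conv_lhs => rw [hr, mul_assoc, ← hr, hw]
  have hr2' : r' * r' = r' := by
    conv_lhs => rw [hr', mul_assoc, hws']
  set k := 1 - r - r' with hk
  have hkA : k ∈ A := sub_mem (sub_mem (one_mem _) hrA) hrA'
  have hks : star k = k := by rw [hk, star_sub, star_sub, star_one, hrs, hrs']
  have hrk : r * k = 0 := by rw [hk, mul_sub, mul_sub, mul_one, hr2, hor, sub_self, sub_zero]
  have hrk' : r' * k = 0 := by rw [hk, mul_sub, mul_sub, mul_one, hr2', hor', sub_zero, sub_self]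
  have hkr : k * r = 0 := by rw [(hA.comm _ hkA _ hrA).eq, hrk]
  have hkr' : k * r' = 0 := by rw [(hA.comm _ hkA _ hrA').eq, hrk']
  have hk2 : k * k = k := by
    nth_rw 1 [hk]
    rw [sub_mul, sub_mul, hrk, hrk', one_mul, sub_zero, sub_zero]
  set u := w + star w + k with hu
  have hus : star u = u := by rw [hu, star_add, star_add, star_star, hks, add_comm (star w)]
  -- the cross terms of `u a u` vanish
  have hconj : ∀ a ∈ A, u * a * u = w * a * star w + star w * a * w + k * a * k := by
    intro a ha
    have ca := fun b (hb : b ∈ A) => (hA.comm a ha b hb).eq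
    have z1 : w * a * w = 0 := by
      calc w * a * w = w * r * a * (r' * w) := by rw [hw, hw']
        _ = w * (r * a) * r' * w := by noncomm_ring
        _ = w * a * (r * r') * w := by rw [← ca r hrA]; noncomm_ring
        _ = 0 := by rw [hor, mul_zero, zero_mul]
    have z2 : w * a * k = 0 := by
      calc w * a * k = w * (r * a) * k := by rw [← mul_assoc, hw]
        _ = w * a * (r * k) := by rw [← ca r hrA]; noncomm_ring
        _ = 0 := by rw [hrk, mul_zero]
    have z3 : star w * a * star w = 0 := by
      calc star w * a * star w = star w * (r' * a) * (r * star w) := by rw [hws, ← mul_assoc, hws']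
        _ = star w * a * (r' * r) * star w := by rw [← ca r' hrA']; noncomm_ring
        _ = 0 := by rw [hor', mul_zero, zero_mul]
    have z4 : star w * a * k = 0 := by
      calc star w * a * k = star w * (r' * a) * k := by rw [← mul_assoc, hws']
        _ = star w * a * (r' * k) := by rw [← ca r' hrA']; noncomm_ring
        _ = 0 := by rw [hrk', mul_zero]
    have z5 : k * a * w = 0 := by
      calc k * a * w = k * (a * r') * w := by rw [← hw']; nth_rw 1 [← hw']; noncomm_ring
        _ = k * r' * a * w := by rw [ca r' hrA']; noncomm_ring
        _ = 0 := by rw [hkr', zero_mul, zero_mul]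
    have z6 : k * a * star w = 0 := by
      calc k * a * star w = k * (a * r) * star w := by
            rw [mul_assoc k (a * r), mul_assoc a, hws, ← mul_assoc]
        _ = k * r * a * star w := by rw [ca r hrA]; noncomm_ring
        _ = 0 := by rw [hkr, zero_mul, zero_mul]
    calc u * a * u = w * a * w + w * a * star w + w * a * k + (star w * a * w + star w * a * star w
          + star w * a * k) + (k * a * w + k * a * star w + k * a * k) := by rw [hu]; noncomm_ring
      _ = _ := by rw [z1, z2, z3, z4, z5, z6]; abel
  have huA : ∀ a ∈ A, u * a * u ∈ A := fun a ha => by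
    rw [hconj a ha]
    exact add_mem (add_mem (h1 a ha) (h2 a ha)) (mul_mem (mul_mem hkA ha) hkA)
  have huu : u * u = 1 := by
    have := hconj 1 (one_mem _)
    rw [mul_one, mul_one, mul_one, mul_one, ← hr, ← hr', hk2] at this
    rw [this, hk]; abel
  have hnorm : u ∈ normalizingUnitaries A := by
    refine ⟨Unitary.mem_iff.2 ⟨by rw [hus, huu], by rw [hus, huu]⟩, ?_⟩
    rw [hus]
    refine Set.Subset.antisymm ?_ fun a ha => ⟨u * a * u, huA a ha, ?_⟩
    · rintro _ ⟨a, ha, rfl⟩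
      exact huA a ha
    · calc u * (u * a * u) * u = u * u * a * (u * u) := by noncomm_ring
        _ = a := by rw [huu, one_mul, mul_one]
  have huA' : u ∈ A := hsing hnorm
  have hur : u * r = w := by
    rw [hu, add_mul, add_mul, hw, hswr, hkr, add_zero, add_zero]
  rw [← hw', ← hur, ← mul_assoc, (hA.comm _ hrA' _ huA').eq, mul_assoc, hor', mul_zero]

/-- A partial isometry whose conjugations map the singular masa `A` into itself lies in `A`, if its
initial projection does. -/
lemma IsTracialRep.conj_eq (h : IsTracialRep τ π Ω) (hA : IsCyclicMasa A v) (hsing : IsSingular A)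
    {w : R} (h1 : ∀ a ∈ A, w * a * star w ∈ A)
    (h2 : ∀ a ∈ A, star w * a * w ∈ A) {s : R} (hs : s ∈ A) (hss : star s = s) (hs2 : s * s = s)
    (hsf : s * (star w * w) = s) : w * s * star w = s := by
  set f := star w * w with hf
  set s' := w * s * star w with hs'
  have hfA : f ∈ A := by simpa using h2 1 (one_mem _)
  have hsA' : s' ∈ A := h1 s hs
  have hss' : star s' = s' := by rw [hs', star_mul, star_mul, star_star, hss, mul_assoc]
  have hs2' : s' * s' = s' := by
    calc s' * s' = w * (s * (star w * w) * s) * star w := by rw [hs']; noncomm_ring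
      _ = s' := by rw [← hf, hsf, hs2]
  have cs := (hA.comm _ hs _ hsA').eq
  -- the part of `s` orthogonal to its image vanishes
  set r₀ := s * (1 - s') with hr₀
  have hr₀A : r₀ ∈ A := mul_mem hs (sub_mem (one_mem _) hsA')
  have hr₀s : star r₀ = r₀ := by
    rw [hr₀, star_mul, star_sub, star_one, hss, hss', mul_sub, sub_mul, cs, mul_one, one_mul]
  have hr₀ss : r₀ * s = r₀ := by
    rw [hr₀, mul_assoc, sub_mul, ← cs, one_mul, mul_sub, hs2, ← mul_assoc, hs2, mul_sub, mul_one]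
  have hr₀s' : r₀ * s' = 0 := by
    rw [hr₀, mul_assoc, sub_mul, one_mul, hs2', sub_self, mul_zero]
  have hr₀2 : r₀ * r₀ = r₀ := by
    nth_rw 2 [hr₀]
    rw [← mul_assoc, hr₀ss, mul_sub, hr₀s', mul_one, sub_zero]
  have hr₀f : r₀ * f = r₀ := by rw [← hr₀ss, mul_assoc, hsf]
  have hfr₀ : f * r₀ = r₀ := by rw [(hA.comm _ hfA _ hr₀A).eq, hr₀f]
  have hini : star (w * r₀) * (w * r₀) = r₀ := by
    rw [star_mul, hr₀s, mul_assoc, ← mul_assoc (star w), ← hf, hfr₀, hr₀2]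
  have hw0 : w * r₀ = 0 := by
    refine eq_zero_of_orthogonal hA hsing (w := w * r₀) ?_ ?_ ?_ ?_
    · rw [hini, mul_assoc, hr₀2]
    · have e1 : w * r₀ * star (w * r₀) = s' * (w * r₀ * star w) := by
        rw [star_mul, hr₀s, hs']
        calc w * r₀ * (r₀ * star w) = w * (r₀ * r₀) * star w := by noncomm_ring
          _ = w * (r₀ * s) * star w := by rw [hr₀2, hr₀ss]
          _ = w * (s * (f * r₀)) * star w := by rw [hfr₀, (hA.comm _ hr₀A _ hs).eq]
          _ = w * s * star w * (w * r₀ * star w) := by rw [hf]; noncomm_ring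
      rw [hini, e1, ← mul_assoc, hr₀s', zero_mul]
    · intro a ha
      have := h1 (r₀ * a * r₀) (mul_mem (mul_mem hr₀A ha) hr₀A)
      rw [star_mul, hr₀s]
      simpa only [mul_assoc] using this
    · intro a ha
      have := mul_mem (mul_mem hr₀A (h2 a ha)) hr₀A
      rw [star_mul, hr₀s]
      simpa only [mul_assoc] using this
  have hr0 : r₀ = 0 := by rw [← hini, hw0, mul_zero]
  have hle : s * s' = s := by
    rw [hr₀, mul_sub, mul_one, sub_eq_zero] at hr0
    exact hr0.symm
  -- `s ≤ s'` and both have the same trace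
  have htr : τ s' = τ s := by rw [hs', h.tracial, ← mul_assoc, ← hf, h.tracial, hsf]
  have hd : s' - s = 0 := by
    refine h.faithful _ (norm_eq_zero.1 (pow_eq_zero_iff two_ne_zero |>.1 ?_))
    have e1 := h.trace_star_mul_self (s' - s)
    have e2 : star (s' - s) * (s' - s) = s' - s := by
      rw [star_sub, hss, hss', mul_sub, sub_mul, sub_mul, hs2, hs2', ← cs, hle, sub_self, sub_zero]
    rw [e2, map_sub, htr, sub_self] at e1
    exact_mod_cast e1.symm
  exact sub_eq_zero.1 hd

/-- Let the elements `r_b` determine `A` by commutation. A partial isometry `w` that intertwines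
them with self-adjoint elements of `A` on both sides lies in `A`, if `A` is singular. -/
lemma IsTracialRep.mem_of_intertwines (h : IsTracialRep τ π Ω) (hA : IsCyclicMasa A v)
    (hsing : IsSingular A) {ι : Type*} {r q q' : ι → R}
    (hr : ∀ b, r b ∈ A ∧ star (r b) = r b ∧ r b * r b = r b)
    (hgen : ∀ z, (∀ b, Commute (r b) z) → z ∈ A)
    (hq : ∀ b, q b ∈ A ∧ star (q b) = q b) (hq' : ∀ b, q' b ∈ A ∧ star (q' b) = q' b)
    {w : R} (hw : w * (star w * w) = w)
    (hwl : ∀ b, w * r b = q' b * w) (hwr : ∀ b, r b * w = w * q b) : w ∈ A := by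
  have hwl' : ∀ b, r b * star w = star w * q' b := fun b => by
    have := congrArg star (hwl b)
    rwa [star_mul, star_mul, (hr b).2.1, (hq' b).2] at this
  have hwr' : ∀ b, star w * r b = q b * star w := fun b => by
    have := congrArg star (hwr b)
    rwa [star_mul, star_mul, (hr b).2.1, (hq b).2] at this
  have h1 : ∀ a ∈ A, w * a * star w ∈ A := fun a ha => hgen _ fun b => by
    change r b * (w * a * star w) = w * a * star w * r b
    calc r b * (w * a * star w) = r b * w * a * star w := by noncomm_ring
      _ = w * (q b * a) * star w := by rw [hwr]; noncomm_ring
      _ = w * a * (q b * star w) := by rw [(hA.comm _ (hq b).1 _ ha).eq]; noncomm_ring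
      _ = w * a * star w * r b := by rw [← hwr']; noncomm_ring
  have h2 : ∀ a ∈ A, star w * a * w ∈ A := fun a ha => hgen _ fun b => by
    change r b * (star w * a * w) = star w * a * w * r b
    calc r b * (star w * a * w) = r b * star w * a * w := by noncomm_ring
      _ = star w * (q' b * a) * w := by rw [hwl']; noncomm_ring
      _ = star w * a * (q' b * w) := by rw [(hA.comm _ (hq' b).1 _ ha).eq]; noncomm_ring
      _ = star w * a * w * r b := by rw [← hwl]; noncomm_ring
  set f := star w * w with hf
  have hfA : f ∈ A := by simpa using h2 1 (one_mem _)
  have hfs : star f = f := by rw [hf, star_mul, star_star]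
  have hf2 : f * f = f := by
    nth_rw 1 [hf]
    rw [mul_assoc, hw]
  have hcomm : ∀ s ∈ A, star s = s → s * s = s → s * f = s → s * w = w * s := by
    intro s hs hss hs2 hsf
    have e := h.conj_eq hA hsing h1 h2 hs hss hs2 hsf
    calc s * w = w * s * star w * w := by rw [e]
      _ = w * (s * f) := by rw [hf]; noncomm_ring
      _ = w * s := by rw [hsf]
  have hfw : f * w = w := by rw [hcomm f hfA hfs hf2 hf2, hw]
  refine hgen w fun b => ?_
  obtain ⟨hrA, hrs, hr2⟩ := hr b
  have cf := (hA.comm _ hrA _ hfA).eq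
  have e := hcomm (r b * f) (mul_mem hrA hfA) (by rw [star_mul, hrs, hfs, cf])
    (by rw [mul_assoc, ← mul_assoc f, ← cf, mul_assoc (r b), hf2, ← mul_assoc, hr2])
    (by rw [mul_assoc, hf2])
  change r b * w = w * r b
  calc r b * w = r b * f * w := by rw [mul_assoc, hfw]
    _ = w * (f * r b) := by rw [e, cf]
    _ = w * r b := by rw [← mul_assoc, hw]

/-- A nonzero `z` that intertwines the generating projections `r_b` with elements of `A` on both
sides cannot be orthogonal to a singular masa: the partial isometry `w = z (z* z)^{-1/2} f`, with
`f` a spectral projection of `z* z`, lies in `A`. -/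
lemma IsTracialRep.eq_zero_of_intertwines (h : IsTracialRep τ π Ω) (hA : IsCyclicMasa A v)
    (hsing : IsSingular A) {ι : Type*} {r q q' : ι → R}
    (hr : ∀ b, r b ∈ A ∧ star (r b) = r b ∧ r b * r b = r b)
    (hgen : ∀ z, (∀ b, Commute (r b) z) → z ∈ A)
    (hq : ∀ b, q b ∈ A ∧ star (q b) = q b) (hq' : ∀ b, q' b ∈ A ∧ star (q' b) = q' b)
    {z : R} (hzl : ∀ b, z * r b = q' b * z) (hzr : ∀ b, r b * z = z * q b)
    (hz : condExp τ A z = 0) : z = 0 := by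
  by_contra hz0
  set a := star z * z with ha
  have haA : a ∈ A := hgen a fun b => by
    have hzl' : r b * star z = star z * q' b := by
      have := congrArg star (hzl b)
      rwa [star_mul, star_mul, (hr b).2.1, (hq' b).2] at this
    change r b * (star z * z) = star z * z * r b
    rw [← mul_assoc, hzl', mul_assoc, ← hzl, mul_assoc]
  have has : star a = a := by rw [ha, star_mul, star_star]
  have hpos : 0 < ‖π z Ω‖ ^ 2 := by
    have : ‖π z Ω‖ ≠ 0 := fun h0 => hz0 (h.faithful z (norm_eq_zero.1 h0))
    positivity
  set δ : ℝ := ‖π z Ω‖ ^ 2 / 2 with hδ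
  have hδ0 : 0 < δ := by positivity
  obtain ⟨f, s, t, hfs, hf2, hss, hts, hsf, htf, -, hcm⟩ := h.sign (a - (δ : ℂ) • 1)
    (by rw [star_sub, has]; simp)
  have hav : Commute (a - (δ : ℂ) • 1) v :=
    hA.comm _ (sub_mem haA (A.smul_mem (one_mem _) _)) _ hA.mem
  have hfA : f ∈ A := hA.masa _ (hcm _ hav).1.symm
  have hsA : s ∈ A := hA.masa _ (hcm _ hav).2.1.symm
  -- `f ≠ 0` because `τ(z* z) > δ`
  have hf0 : f ≠ 0 := by
    rintro rfl
    have e1 : a = (δ : ℂ) • 1 - star t * t := by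
      rw [hts, sub_eq_add_neg, ← htf]; simp
    have e2 := congrArg τ e1
    rw [ha, map_sub, map_smul, h.trace_one, h.trace_star_mul_self, h.trace_star_mul_self,
      smul_eq_mul, mul_one] at e2
    have e3 : ‖π z Ω‖ ^ 2 = δ - ‖π t Ω‖ ^ 2 := by exact_mod_cast e2
    nlinarith [sq_nonneg ‖π t Ω‖]
  obtain ⟨k, hk, hkm, hkc⟩ := h.invSqrt s δ hss hδ0
  have hkA : k ∈ A := hA.masa _ (hkc _ (hA.comm _ hsA _ hA.mem)).symm
  have hkf := (hA.comm _ hkA _ hfA).eq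
  set w := z * (k * f) with hw
  have hkfA : k * f ∈ A := mul_mem hkA hfA
  have hww : star w * w = f := by
    have e1 : star w * w = f * k * a * (k * f) := by
      rw [hw, star_mul, star_mul, hk, hfs, ha]; noncomm_ring
    let _ := hA.commRing
    have key : ∀ f k a s c : A, f * f = f → (a - c) * f = s * s → k * k * (c + s * s) = 1 →
        f * k * a * (k * f) = f := by
      intro f k a s c e1 e2 e3
      linear_combination (k * k * a - k * k * (a - c)) * e1 + k * k * f * e2 + f * e3
    rw [e1]
    exact congrArg Subtype.val (key ⟨_, hfA⟩ ⟨_, hkA⟩ ⟨_, haA⟩ ⟨_, hsA⟩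
      ⟨(δ : ℂ) • 1, A.smul_mem (one_mem _) _⟩ (Subtype.ext hf2) (Subtype.ext hsf) (Subtype.ext hkm))
  have hwA : w ∈ A := by
    refine h.mem_of_intertwines hA hsing hr hgen hq hq' (w := w) ?_ (fun b => ?_) fun b => ?_
    · rw [hww, hw, mul_assoc, mul_assoc, hf2]
    · rw [hw, mul_assoc, (hA.comm _ hkfA _ (hr b).1).eq, ← mul_assoc, hzl, mul_assoc]
    · rw [hw, ← mul_assoc, hzr, mul_assoc z, (hA.comm _ (hq b).1 _ hkfA).eq, ← mul_assoc]
  have hw0 : w = 0 := by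
    rw [← h.condExp_of_mem hA hwA, hw, h.condExp_mul_right hA hkfA, hz, zero_mul]
  exact hf0 (by rw [← hww, hw0, mul_zero])

/-- If `y r_b = q_b y` for the tree `r`, then `y* r_b y` lies in `A` and the sums
`∑ ‖y* r_b y‖₂²` are bounded below. This is where traciality enters, through
`τ(y* r y)² ≤ τ(r) ‖r y y* r‖₂² = τ(r) ‖y* r y‖₂²`. -/
lemma IsTracialRep.sum_norm_conj_lower_bound (h : IsTracialRep τ π Ω) (hA : IsCyclicMasa A v)
    {r q : List Bool → R} (hr : IsProjTree A r) (hr1 : r [] = 1)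
    (hgen : ∀ z, (∀ b, Commute (r b) z) → z ∈ A)
    (hq : ∀ b, q b ∈ A ∧ star (q b) = q b) {y : R} (hy : ∀ b, y * r b = q b * y) (n : ℕ) :
    (‖π y Ω‖ ^ 2) ^ 2 ≤
      ∑ b ∈ level n, ‖π (condExp τ A (star y * r b * star (star y))) Ω‖ ^ 2 := by
  have hy' : ∀ b, r b * star y = star y * q b := fun b => by
    have := congrArg star (hy b)
    rwa [star_mul, star_mul, hr.star_eq, (hq b).2] at this
  have hmem : ∀ b, star y * r b * star (star y) ∈ A := fun b => hgen _ fun c => by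
    rw [star_star]
    change r c * (star y * r b * y) = star y * r b * y * r c
    calc r c * (star y * r b * y) = r c * star y * r b * y := by noncomm_ring
      _ = star y * (q c * r b) * y := by rw [hy']; noncomm_ring
      _ = star y * r b * (q c * y) := by
          rw [(hA.comm _ (hq c).1 _ (hr.mem b)).eq]; noncomm_ring
      _ = star y * r b * y * r c := by rw [← hy]; noncomm_ring
  have hsum : ∀ a : R, ∑ b ∈ level n, ‖π (r b * a) Ω‖ ^ 2 = ‖π a Ω‖ ^ 2 := fun a => by
    simp only [map_mul, mul_apply_eq_comp]
    rw [hr.sum_norm_sq, hr1, _root_.map_one]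
    rfl
  have hΩ : ∑ b ∈ level n, ‖π (r b) Ω‖ ^ 2 = 1 := by
    have e1 := h.trace_star_mul_self 1
    rw [star_one, mul_one, h.trace_one] at e1
    rw [hr.sum_norm_sq, hr1]
    exact_mod_cast e1.symm
  have hterm : ∀ b ∈ level n, (‖π (r b * y) Ω‖ ^ 2) ^ 2 ≤ ‖π (r b) Ω‖ ^ 2 *
      ‖π (condExp τ A (star y * r b * star (star y))) Ω‖ ^ 2 := by
    intro b _
    rw [h.condExp_of_mem hA (hmem b), star_star]
    have hrs := hr.star_eq b
    have hr2 := hr.mul_self b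
    have e1 : ((‖π (r b * y) Ω‖ ^ 2 : ℝ) : ℂ) = τ (star (r b) * (r b * (y * star y) * r b)) := by
      rw [← h.trace_star_mul_self, h.tracial, star_mul, hrs]
      congr 1
      calc r b * y * (star y * r b) = r b * (y * star y) * r b := by noncomm_ring
        _ = r b * r b * (y * star y) * r b := by rw [hr2]
        _ = _ := by noncomm_ring
    have e2 : ‖π (r b * (y * star y) * r b) Ω‖ ^ 2 = ‖π (star y * r b * y) Ω‖ ^ 2 := by
      have e3 : τ (star (r b * (y * star y) * r b) * (r b * (y * star y) * r b)) =
          τ (star (star y * r b * y) * (star y * r b * y)) := by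
        simp only [star_mul, star_star, hrs]
        calc τ (r b * (y * star y * r b) * (r b * (y * star y) * r b))
            = τ (r b * y * (star y * (r b * r b) * y * star y * r b)) := by
              congr 1; noncomm_ring
          _ = τ (r b * y * (star y * r b * y * star y * r b)) := by rw [hr2]
          _ = τ (star y * r b * y * star y * (r b * r b) * y) := by
              rw [h.tracial]; congr 1; noncomm_ring
          _ = _ := by rw [hr2]; congr 1; noncomm_ring
      rw [h.trace_star_mul_self, h.trace_star_mul_self] at e3
      exact_mod_cast e3
    have e4 := h.norm_trace_le (r b) (r b * (y * star y) * r b)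
    rw [← e1, Complex.norm_of_nonneg (by positivity)] at e4
    rw [← e2, ← mul_pow]
    gcongr
  have := Finset.sum_sq_le_sum_mul_sum_of_sq_le_mul (level n)
    (fun b _ => by positivity) (fun b _ => by positivity) hterm
  rwa [hsum, hΩ, one_mul] at this

/-- The averages of `‖E_A(x v^k x*)‖₂²` tend to `0` if `E_A(x) = 0` and `A` is singular. -/
theorem IsTracialRep.tendsto_average (h : IsTracialRep τ π Ω) (hA : IsCyclicMasa A v)
    (hsing : IsSingular A)
    (hcomm : ∀ S : K →L[ℂ] K, Commute S (π v) → Commute S (π (star (v : R))) →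
      ∀ a ∈ A, Commute S (π a))
    (hgen : ∃ e : ℕ → R, (∀ n, e n ∈ A ∧ star (e n) = e n ∧ e n * e n = e n) ∧
      ∀ z, (∀ n, Commute (e n) z) → z ∈ A)
    (x : R) (hx : condExp τ A x = 0) :
    Tendsto (fun N : ℕ => (1 / (2 * (N : ℝ) + 1)) * ∑ k ∈ Finset.Icc (-(N : ℤ)) (N : ℤ),
      ‖π (condExp τ A (x * ((v ^ k : unitary R) : R) * star x)) Ω‖ ^ 2) atTop (𝓝 0) := by
  by_contra hcon
  obtain ⟨e, he, hegen⟩ := hgen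
  set r : List Bool → R := projTree 1 (fun b => e b.length) with hrdef
  have hr : IsProjTree A r := isProjTree_projTree hA ⟨one_mem _, star_one _, mul_one _⟩
    (fun b => he _)
  have hr1 : r [] = 1 := rfl
  have hgen : ∀ z, (∀ b, Commute (r b) z) → z ∈ A := by
    refine fun z hz => hegen z fun n => ?_
    have : e n = ∑ b ∈ level n, r (true :: b) := by
      calc e n = (∑ b ∈ level n, r b) * e n := by rw [hr.sum_level, hr1, one_mul]
        _ = _ := by
          rw [Finset.sum_mul]
          refine Finset.sum_congr rfl fun b hb => ?_
          rw [← mem_level.1 hb]; rfl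
    rw [this]
    exact Commute.sum_left _ _ _ fun b _ => hz _
  have hr' : ∀ b, r b ∈ A ∧ star (r b) = r b ∧ r b * r b = r b := fun b =>
    ⟨hr.mem b, hr.star_eq b, hr.mul_self b⟩
  obtain ⟨c, hc, hlow⟩ := h.exists_lower_bound hA hcomm x hcon
  obtain ⟨y, q, hy0, hq, hyr, hyE, -⟩ := h.exists_intertwiner hA hr hr1 x hc fun n =>
    hlow (level n) r (fun b _ => hr' b) (by rw [hr.sum_level, hr1])
  have hypos : 0 < (‖π y Ω‖ ^ 2) ^ 2 := by
    have : ‖π y Ω‖ ≠ 0 := fun h0 => hy0 (h.faithful y (norm_eq_zero.1 h0))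
    positivity
  obtain ⟨z, q', hz0, hq', hzr, hzE, hzc⟩ := h.exists_intertwiner hA hr hr1 (star y) hypos
    (h.sum_norm_conj_lower_bound hA hr hr1 hgen hq hyr)
  refine hz0 (h.eq_zero_of_intertwines hA hsing hr' hgen hq hq' hzr (fun b => ?_) (hzE ?_))
  · refine hzc _ (hr.mem b) _ (hq b).1 ?_
    have := congrArg star (hyr b)
    rwa [star_mul, star_mul, hr.star_eq, (hq b).2] at this
  · rw [h.condExp_star hA, hyE hx, star_zero]

end Normalizer

/-! ### From averages to powers -/

/-- A nonnegative sequence whose symmetric averages tend to `0` has arbitrarily late small terms. -/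
lemma exists_nat_lt_of_tendsto_average {f : ℤ → ℝ} (hf0 : ∀ k, 0 ≤ f k)
    (hf : Tendsto (fun N : ℕ => (1 / (2 * (N : ℝ) + 1)) * ∑ k ∈ Finset.Icc (-(N : ℤ)) (N : ℤ), f k)
      atTop (𝓝 0)) {ε : ℝ} (hε : 0 < ε) (n₀ : ℕ) : ∃ k : ℕ, n₀ ≤ k ∧ f k < ε := by
  by_contra! hcon
  obtain ⟨N, hN, hNle⟩ := ((hf.eventually_lt_const (by positivity : (0 : ℝ) < ε / 4)).and
    (eventually_ge_atTop (2 * n₀ + 1))).exists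
  have h1 : ((N : ℝ) - n₀) * ε ≤ ∑ k ∈ Finset.Icc (-(N : ℤ)) (N : ℤ), f k := by
    calc ((N : ℝ) - n₀) * ε ≤ ((Finset.Icc (n₀ : ℤ) (N : ℤ)).card : ℝ) * ε := by
          gcongr
          rw [Int.card_Icc]
          have : (((N : ℤ) + 1 - n₀).toNat : ℤ) = N + 1 - n₀ := Int.toNat_of_nonneg (by omega)
          have h2 : (((N : ℤ) + 1 - n₀).toNat : ℝ) = N + 1 - n₀ := by exact_mod_cast this
          rw [h2]; linarith
      _ = ∑ k ∈ Finset.Icc (n₀ : ℤ) (N : ℤ), ε := by rw [Finset.sum_const, nsmul_eq_mul]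
      _ ≤ ∑ k ∈ Finset.Icc (n₀ : ℤ) (N : ℤ), f k := by
          refine Finset.sum_le_sum fun k hk => ?_
          rw [Finset.mem_Icc] at hk
          obtain ⟨m, rfl⟩ := Int.eq_ofNat_of_zero_le (show 0 ≤ k by omega)
          exact hcon m (by omega)
      _ ≤ _ := Finset.sum_le_sum_of_subset_of_nonneg
          (Finset.Icc_subset_Icc (by omega) le_rfl) fun k _ _ => hf0 k
  have hpos : 0 < 2 * (N : ℝ) + 1 := by positivity
  rw [one_div, inv_mul_eq_div, div_lt_iff₀ hpos] at hN
  have h3 : (2 * (n₀ : ℝ) + 1) ≤ N := by exact_mod_cast hNle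
  nlinarith

section Polarization

variable {R : Type*} [Ring R] [StarRing R] [Algebra ℂ R] [StarModule ℂ R]

omit [StarRing R] [StarModule ℂ R] in
lemma tendsto_average_sum {ι : Type*} (s : Finset ι) (f : ι → ℤ → ℝ)
    (hf : ∀ i ∈ s, Tendsto (fun N : ℕ => (1 / (2 * (N : ℝ) + 1)) *
      ∑ k ∈ Finset.Icc (-(N : ℤ)) (N : ℤ), f i k) atTop (𝓝 0)) :
    Tendsto (fun N : ℕ => (1 / (2 * (N : ℝ) + 1)) *
      ∑ k ∈ Finset.Icc (-(N : ℤ)) (N : ℤ), ∑ i ∈ s, f i k) atTop (𝓝 0) := by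
  have := tendsto_finsetSum s hf
  rw [Finset.sum_const_zero] at this
  refine this.congr fun N => ?_
  rw [Finset.sum_comm, Finset.mul_sum]

/-- Polarization of `x w y*` in `x` and `y`. -/
lemma polarization_star (x y w : R) :
    (4 : ℂ) • (x * w * star y) = ∑ m ∈ Finset.range 4, (Complex.I ^ m) •
      ((x + Complex.I ^ m • y) * w * star (x + Complex.I ^ m • y)) := by
  have h2 : Complex.I ^ 2 = -1 := Complex.I_sq
  have h3 : Complex.I ^ 3 = -Complex.I := by rw [pow_succ, h2]; ring
  simp only [Finset.sum_range_succ, Finset.sum_range_zero, h2, h3, pow_zero, pow_one, one_smul,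
    zero_add, star_add, star_smul, add_mul, mul_add, smul_mul_assoc, mul_smul_comm,
    smul_add, smul_smul, neg_smul, neg_mul, mul_neg, Complex.star_def, Complex.conj_I,
    Complex.I_mul_I, neg_neg, map_one, map_neg]
  module

variable {K : Type*} [NormedAddCommGroup K] [InnerProductSpace ℂ K] [CompleteSpace K]
variable {τ : R →ₗ[ℂ] ℂ} {π : R →⋆ₐ[ℂ] (K →L[ℂ] K)} {Ω : K} {A : StarSubalgebra ℂ R}
  {v : unitary R}

/-- If all averages of `‖E_A(x v^k x*)‖₂²` with `E_A(x) = 0` tend to `0`, then suitable powers of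
`v` are asymptotically multiplicative for `E_A`, by polarization. -/
theorem IsTracialRep.exists_pow_lt (h : IsTracialRep τ π Ω) (hA : IsCyclicMasa A v)
    (havg : ∀ x, condExp τ A x = 0 → Tendsto (fun N : ℕ => (1 / (2 * (N : ℝ) + 1)) *
      ∑ k ∈ Finset.Icc (-(N : ℤ)) (N : ℤ),
        ‖π (condExp τ A (x * ((v ^ k : unitary R) : R) * star x)) Ω‖ ^ 2) atTop (𝓝 0))
    {ε : ℝ} (hε : 0 < ε) (n : ℕ) (x : Fin n → R) (n₀ : ℕ) : ∃ k : ℕ, n₀ ≤ k ∧ ∀ i j : Fin n,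
      ‖π (condExp τ A (x i * (v : R) ^ k * star (x j)) -
        condExp τ A (x i) * (v : R) ^ k * condExp τ A (star (x j))) Ω‖ < ε := by
  set x' : Fin n → R := fun i => x i - condExp τ A (x i) with hx'
  have hx'0 : ∀ i, condExp τ A (x' i) = 0 := fun i => by
    simp only [hx']
    rw [h.condExp_sub hA, h.condExp_of_mem hA (h.condExp_mem hA _), sub_self]
  set X : (Fin n × Fin n) × ℕ → R := fun p => x' p.1.1 + Complex.I ^ p.2 • x' p.1.2 with hX
  have hX0 : ∀ p, condExp τ A (X p) = 0 := fun p => by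
    simp only [hX]
    rw [h.condExp_add hA, h.condExp_smul hA, hx'0, hx'0, smul_zero, add_zero]
  have hlim := tendsto_average_sum (Finset.univ ×ˢ Finset.range 4)
    (fun p k => ‖π (condExp τ A (X p * ((v ^ k : unitary R) : R) * star (X p))) Ω‖ ^ 2)
    (fun p _ => havg _ (hX0 p))
  obtain ⟨k, hk, hlt⟩ := exists_nat_lt_of_tendsto_average
    (fun k => Finset.sum_nonneg fun p _ => sq_nonneg _) hlim (by positivity : 0 < ε ^ 2) n₀
  refine ⟨k, hk, fun i j => ?_⟩
  set w : R := (v : R) ^ k with hw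
  have hwv : ((v ^ (k : ℤ) : unitary R) : R) = w := by
    rw [zpow_natCast, SubmonoidClass.coe_pow]
  have hwA : w ∈ A := pow_mem hA.mem k
  rw [hwv] at hlt
  have hterm : ∀ m ∈ Finset.range 4,
      ‖π (condExp τ A (X ((i, j), m) * w * star (X ((i, j), m)))) Ω‖ < ε := by
    intro m hm
    have h1 := (Finset.single_le_sum (f := fun p : (Fin n × Fin n) × ℕ =>
      ‖π (condExp τ A (X p * w * star (X p))) Ω‖ ^ 2) (fun p _ => sq_nonneg _)
      (show ((i, j), m) ∈ Finset.univ ×ˢ Finset.range 4 from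
        Finset.mem_product.2 ⟨Finset.mem_univ _, hm⟩)).trans_lt hlt
    exact lt_of_pow_lt_pow_left₀ 2 hε.le h1
  have hsplit : condExp τ A (x i * w * star (x j)) -
      condExp τ A (x i) * w * condExp τ A (star (x j)) = condExp τ A (x' i * w * star (x' j)) := by
    have hi := h.condExp_mem hA (x i)
    have hj := h.condExp_mem hA (x j)
    have e1 : x' i * w * star (x' j) = x i * w * star (x j) -
        condExp τ A (x i) * w * star (x j) - x i * (w * star (condExp τ A (x j)))
        + condExp τ A (x i) * w * star (condExp τ A (x j)) := by
      simp only [hx', star_sub]; noncomm_ring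
    rw [e1, h.condExp_add hA, h.condExp_sub hA, h.condExp_sub hA,
      h.condExp_mul_left hA (mul_mem hi hwA), h.condExp_mul_right hA (mul_mem hwA (star_mem hj)),
      h.condExp_of_mem hA (mul_mem (mul_mem hi hwA) (star_mem hj)), h.condExp_star hA]
    noncomm_ring
  have hpol : (4 : ℂ) • condExp τ A (x' i * w * star (x' j)) = ∑ m ∈ Finset.range 4,
      Complex.I ^ m • condExp τ A (X ((i, j), m) * w * star (X ((i, j), m))) := by
    rw [← h.condExp_smul hA, polarization_star, h.condExp_sum hA]
    exact Finset.sum_congr rfl fun m _ => h.condExp_smul hA _ _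
  rw [hsplit]
  have hnorm : 4 * ‖π (condExp τ A (x' i * w * star (x' j))) Ω‖ < 4 * ε := by
    have e1 : ‖π ((4 : ℂ) • condExp τ A (x' i * w * star (x' j))) Ω‖ =
        4 * ‖π (condExp τ A (x' i * w * star (x' j))) Ω‖ := by
      rw [map_smul, smul_apply, norm_smul]; norm_num
    rw [← e1, hpol, map_sum, sum_apply]
    calc _ ≤ ∑ m ∈ Finset.range 4,
          ‖π (Complex.I ^ m • condExp τ A (X ((i, j), m) * w * star (X ((i, j), m)))) Ω‖ :=
          norm_sum_le _ _
      _ < ∑ _m ∈ Finset.range 4, ε := by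
          refine Finset.sum_lt_sum_of_nonempty (by simp) fun m hm => ?_
          rw [map_smul, smul_apply, norm_smul, norm_pow, Complex.norm_I, one_pow, one_mul]
          exact hterm m hm
      _ = 4 * ε := by simp
  linarith

end Polarization

/-! ### Spectral projections and functional calculus in von Neumann algebras -/

section FunctionalCalculus

variable {H : Type*} [NormedAddCommGroup H] [InnerProductSpace ℂ H] [CompleteSpace H]

/-- The support projection `e` of a self-adjoint `s`: the complement of the projection onto the
kernel of `s`. It commutes with every `y` such that `y` and `y*` commute with `s`. -/
lemma exists_support (s : H →L[ℂ] H) (hs : star s = s) : ∃ e : H →L[ℂ] H, star e = e ∧ e * e = e ∧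
    e * s = s ∧ (∀ y, s * y = 0 → e * y = 0) ∧ ∀ y, Commute s y → Commute s (star y) →
      Commute e y := by
  have : (s.ker).HasOrthogonalProjection := by
    have : CompleteSpace s.ker := s.isClosed_ker.completeSpace_coe
    infer_instance
  set q : H →L[ℂ] H := (s.ker).starProjection with hq
  have hqs : star q = q := isStarProjection_starProjection.isSelfAdjoint
  have hqq : q * q = q := isStarProjection_starProjection.isIdempotentElem
  have hfix : ∀ y : H →L[ℂ] H, s * y = 0 → q * y = y := by
    intro y hy
    ext ξ
    refine Submodule.starProjection_eq_self_iff.2 ?_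
    exact congr($hy ξ)
  have hsq : s * q = 0 := by
    ext ξ
    exact LinearMap.mem_ker.1 (Submodule.starProjection_apply_mem s.ker ξ)
  have hqs0 : q * s = 0 := by
    rw [← hqs, ← hs, ← star_mul, hsq, star_zero]
  have hinv : ∀ y, Commute s y → q * (y * q) = y * q := fun y hy =>
    hfix _ (by rw [← mul_assoc, hy.eq, mul_assoc, hsq, mul_zero])
  refine ⟨1 - q, by simp [hqs], by
    rw [mul_sub, sub_mul, sub_mul, hqq]; simp, by rw [sub_mul, hqs0]; simp,
    fun y hy => by rw [sub_mul, hfix y hy]; simp, fun y hy hy' => ?_⟩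
  refine (Commute.one_left y).sub_left ?_
  have h1 := hinv y hy
  have h2 := congrArg star (hinv _ hy')
  simp only [star_mul, star_star, hqs] at h2
  rw [mul_assoc] at h2
  exact h2.symm.trans h1

/-- The spectral projection `e` of a self-adjoint operator `h` for `(0, ∞)`, with the square roots
`s` and `t` of the positive and the negative part of `h`. If `‖h‖ ≤ C`, then subtracting the
multiple `C / 2` of the symmetry `2e - 1` leaves an operator of norm at most `C / 2`. -/
lemma exists_sign (h : H →L[ℂ] H) (hh : star h = h) : ∃ e s t : H →L[ℂ] H, star e = e ∧ e * e = e ∧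
    star s = s ∧ star t = t ∧ h * e = s * s ∧ h * (1 - e) = -(t * t) ∧
    (∀ y, s * y = 0 → e * y = 0) ∧
    (∀ y, Commute h y → Commute e y ∧ Commute s y ∧ Commute t y) ∧
    ∀ C : ℝ, ‖h‖ ≤ C → ‖h - ((C / 2 : ℝ) : ℂ) • (e + e - 1)‖ ≤ C / 2 := by
  have hsa : IsSelfAdjoint h := hh
  set s : H →L[ℂ] H := cfc (fun x : ℝ => √x) h with hs
  set t : H →L[ℂ] H := cfc (fun x : ℝ => √(-x)) h with ht
  have hss : star s = s := (cfc_predicate _ h : IsSelfAdjoint s)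
  have htt : star t = t := (cfc_predicate _ h : IsSelfAdjoint t)
  have hst : s * t = 0 := by
    rw [hs, ht, ← cfc_mul _ _ h (by fun_prop) (by fun_prop)]
    have : (fun x : ℝ => √x * √(-x)) = fun _ => 0 := by
      funext x
      rcases le_total x 0 with hx | hx
      · rw [Real.sqrt_eq_zero_of_nonpos hx, zero_mul]
      · rw [Real.sqrt_eq_zero_of_nonpos (neg_nonpos.2 hx), mul_zero]
    rw [this, cfc_const_zero]
  have hsub : h = s * s - t * t := by
    rw [hs, ht, ← cfc_mul _ _ h (by fun_prop) (by fun_prop),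
      ← cfc_mul _ _ h (by fun_prop) (by fun_prop), ← cfc_sub _ _ h (by fun_prop) (by fun_prop)]
    conv_lhs => rw [← cfc_id ℝ h]
    congr 1
    funext x
    rcases le_total x 0 with hx | hx
    · simp [Real.sqrt_eq_zero_of_nonpos hx, Real.mul_self_sqrt (neg_nonneg.2 hx)]
    · simp [Real.sqrt_eq_zero_of_nonpos (neg_nonpos.2 hx), Real.mul_self_sqrt hx]
  obtain ⟨e, he, hee, hes, hker, hcomm⟩ := exists_support s hss
  have hse : s * e = s := by
    have := congrArg star hes
    rwa [star_mul, he, hss] at this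
  have het : e * t = 0 := hker t hst
  have hte : t * e = 0 := by
    have := congrArg star het
    rwa [star_mul, he, htt, star_zero] at this
  have hhe : h * e = s * s := by rw [hsub, sub_mul, mul_assoc, mul_assoc, hse, hte]; simp
  refine ⟨e, s, t, he, hee, hss, htt, hhe, ?_, hker, fun y hy => ?_, fun C hC => ?_⟩
  · rw [mul_sub, hhe, mul_one, hsub]; abel
  · have hy' : Commute h (star y) := by
      have := hy.star_star
      rwa [hh] at this
    exact ⟨hcomm y (hy.cfc_real _) (hy'.cfc_real _), hy.cfc_real _, hy.cfc_real _⟩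
  · -- The left side is `(|h| - C / 2) (2e - 1)`, where `2e - 1` is unitary.
    have hsym : e + e - 1 ∈ unitary (H →L[ℂ] H) := by
      have h1 : star (e + e - 1) = e + e - 1 := by simp [he]
      have h2 : (e + e - 1) * (e + e - 1) = 1 := by
        simp only [mul_sub, sub_mul, mul_add, add_mul, hee, mul_one, one_mul]; abel
      exact Unitary.mem_iff.2 ⟨by rw [h1, h2], by rw [h1, h2]⟩
    have habs : h - ((C / 2 : ℝ) : ℂ) • (e + e - 1) =
        cfc (fun x : ℝ => |x| - C / 2) h * (e + e - 1) := by
      have h1 : cfc (fun x : ℝ => |x| - C / 2) h =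
          s * s + t * t - ((C / 2 : ℝ) : ℂ) • (1 : H →L[ℂ] H) := by
        rw [cfc_sub (fun x : ℝ => |x|) (fun _ => C / 2) h (by fun_prop) (by fun_prop),
          cfc_const (C / 2) h,
          Algebra.algebraMap_eq_smul_one, hs, ht, ← cfc_mul _ _ h (by fun_prop) (by fun_prop),
          ← cfc_mul _ _ h (by fun_prop) (by fun_prop), ← cfc_add h _ _ (by fun_prop) (by fun_prop)]
        congr 2
        funext x
        rcases le_total x 0 with hx | hx
        · simp [Real.sqrt_eq_zero_of_nonpos hx, Real.mul_self_sqrt (neg_nonneg.2 hx),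
            abs_of_nonpos hx]
        · simp [Real.sqrt_eq_zero_of_nonpos (neg_nonpos.2 hx), Real.mul_self_sqrt hx,
            abs_of_nonneg hx]
      rw [h1, sub_mul, smul_mul_assoc, one_mul]
      congr 1
      simp only [mul_sub, mul_add, add_mul, mul_assoc, hse, hte, mul_zero, mul_one]
      rw [hsub]; abel
    rw [habs, CStarRing.norm_mul_mem_unitary _ hsym]
    refine norm_cfc_le (by linarith [norm_nonneg h]) fun x hx => ?_
    have hx' : |x| ≤ C := by
      refine (spectrum.norm_le_norm_mul_of_mem hx).trans ((mul_le_of_le_one_right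
        (norm_nonneg _) ContinuousLinearMap.norm_id_le).trans hC)
    rw [Real.norm_eq_abs, abs_le]
    constructor <;> linarith [abs_nonneg x]

/-- The inverse square root of `δ + s²`. -/
lemma exists_invSqrt (s : H →L[ℂ] H) (δ : ℝ) (hs : star s = s) (hδ : 0 < δ) :
    ∃ k : H →L[ℂ] H, star k = k ∧ k * k * ((δ : ℂ) • 1 + s * s) = 1 ∧
      ∀ y, Commute s y → Commute k y := by
  have hsa : IsSelfAdjoint s := hs
  have hpos : ∀ x : ℝ, 0 < δ + x * x := fun x => by nlinarith [mul_self_nonneg x]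
  have hcont : Continuous fun x : ℝ => (√(δ + x * x))⁻¹ :=
    Continuous.inv₀ (by fun_prop) fun x => (Real.sqrt_pos.2 (hpos x)).ne'
  refine ⟨cfc (fun x : ℝ => (√(δ + x * x))⁻¹) s,
    (cfc_predicate _ s : IsSelfAdjoint (cfc (fun x : ℝ => (√(δ + x * x))⁻¹) s)), ?_,
    fun y hy => hy.cfc_real _⟩
  have h1 : (δ : ℂ) • (1 : H →L[ℂ] H) + s * s = cfc (fun x : ℝ => δ + x * x) s := by
    rw [cfc_add s (fun _ : ℝ => δ) (fun x => x * x) (by fun_prop) (by fun_prop),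
      cfc_mul (fun x : ℝ => x) (fun x => x) s (by fun_prop) (by fun_prop), cfc_id' ℝ s,
      cfc_const δ s, Algebra.algebraMap_eq_smul_one]
    rfl
  have hcont' : Continuous fun x : ℝ => (√(δ + x * x))⁻¹ * (√(δ + x * x))⁻¹ := hcont.mul hcont
  rw [h1, ← cfc_mul _ _ s hcont.continuousOn hcont.continuousOn,
    ← cfc_mul _ _ s hcont'.continuousOn (by fun_prop)]
  have : (fun x : ℝ => (√(δ + x * x))⁻¹ * (√(δ + x * x))⁻¹ * (δ + x * x)) = fun _ => 1 := by
    funext x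
    rw [← mul_inv, Real.mul_self_sqrt (hpos x).le, inv_mul_cancel₀ (hpos x).ne']
  rw [this, cfc_const_one ℝ s]

/-- An operator commuting with everything that commutes with an element of a von Neumann algebra
lies in that von Neumann algebra. -/
lemma mem_of_forall_commute (M : VonNeumannAlgebra H) {a z : H →L[ℂ] H} (ha : a ∈ M)
    (hz : ∀ y, Commute a y → Commute z y) : z ∈ M := by
  rw [← M.commutant_commutant, VonNeumannAlgebra.mem_commutant_iff]
  intro g hg
  exact (hz g (VonNeumannAlgebra.mem_commutant_iff.1 hg a ha)).eq.symm

end FunctionalCalculus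

/-! ### The amplified representation -/

section Amplification

variable {H : Type*} [NormedAddCommGroup H] [InnerProductSpace ℂ H] [CompleteSpace H]

/-- The diagonal operator `T ⊕ T ⊕ ⋯` on the Hilbert sum of countably many copies of `H`. -/
noncomputable def diagCLM (T : H →L[ℂ] H) :
    lp (fun _ : ℕ => H) 2 →L[ℂ] lp (fun _ : ℕ => H) 2 :=
  lp.mapCLM 2 (fun _ => T) (norm_nonneg T) fun _ => le_rfl

omit [CompleteSpace H] in
lemma diagCLM_apply (T : H →L[ℂ] H) (f : lp (fun _ : ℕ => H) 2) (i : ℕ) :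
    (diagCLM T f : ℕ → H) i = T (f i) := rfl

omit [CompleteSpace H] in
lemma diagCLM_single (T : H →L[ℂ] H) (i : ℕ) (ξ : H) :
    diagCLM T (lp.single 2 i ξ) = lp.single 2 i (T ξ) := by
  ext j
  rw [diagCLM_apply]
  rcases eq_or_ne j i with rfl | hij
  · rw [lp.single_apply_self, lp.single_apply_self]
  · rw [lp.single_apply_ne _ _ _ hij, lp.single_apply_ne _ _ _ hij, map_zero]

lemma norm_diagCLM (T : H →L[ℂ] H) : ‖diagCLM T‖ = ‖T‖ := by
  refine le_antisymm (lp.norm_mapCLM_le 2 _ _ _) (T.opNorm_le_bound (norm_nonneg _) fun ξ => ?_)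
  have h2 : (0 : ENNReal) < 2 := by norm_num
  have := (diagCLM T).le_opNorm (lp.single 2 0 ξ)
  rwa [diagCLM_single, lp.norm_single h2, lp.norm_single h2] at this

/-- The representation of `B(H)` on the Hilbert sum of countably many copies of `H`. Every normal
state is implemented by a vector of this representation. -/
noncomputable def amplification (H : Type*) [NormedAddCommGroup H] [InnerProductSpace ℂ H]
    [CompleteSpace H] :
    (H →L[ℂ] H) →⋆ₐ[ℂ] (lp (fun _ : ℕ => H) 2 →L[ℂ] lp (fun _ : ℕ => H) 2) where
  toFun := diagCLM
  map_one' := by ext f i; rfl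
  map_mul' S T := by ext f i; rfl
  map_zero' := by ext f i; rfl
  map_add' S T := by ext f i; rfl
  commutes' c := by ext f i; simp [diagCLM_apply, Algebra.algebraMap_eq_smul_one]
  map_star' T := by
    rw [ContinuousLinearMap.star_eq_adjoint, ContinuousLinearMap.star_eq_adjoint]
    refine (ContinuousLinearMap.eq_adjoint_iff _ _).2 fun f g => ?_
    rw [lp.inner_eq_tsum, lp.inner_eq_tsum]
    refine tsum_congr fun i => ?_
    rw [diagCLM_apply, diagCLM_apply, ContinuousLinearMap.adjoint_inner_left]

lemma norm_amplification (T : H →L[ℂ] H) : ‖amplification H T‖ = ‖T‖ := norm_diagCLM T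

/-- An operator on the Hilbert sum commutes with the amplification of `b` exactly if its matrix
entries commute with `b`. So the bicommutant may be computed before or after amplification. -/
lemma commute_amplification_of_mem_centralizer {s : Set (H →L[ℂ] H)} {a : H →L[ℂ] H}
    (ha : a ∈ Set.centralizer (Set.centralizer s))
    {S : lp (fun _ : ℕ => H) 2 →L[ℂ] lp (fun _ : ℕ => H) 2}
    (hS : ∀ b ∈ s, Commute S (amplification H b)) : Commute S (amplification H a) := by
  set E : ℕ → ℕ → H →L[ℂ] H := fun i j =>
    (lp.evalCLM ℂ (fun _ : ℕ => H) 2 i).comp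
      (S.comp (lp.singleContinuousLinearMap ℂ (fun _ : ℕ => H) 2 j)) with hE
  have hEapp : ∀ i j ξ, E i j ξ = (S (lp.single 2 j ξ) : ℕ → H) i := fun i j ξ => rfl
  have hmem : ∀ i j, E i j ∈ Set.centralizer s := by
    intro i j
    refine Set.mem_centralizer_iff.2 fun b hb => ?_
    ext ξ
    have h1 := congr((($((hS b hb).eq) (lp.single 2 j ξ) : lp (fun _ : ℕ => H) 2) : ℕ → H) i)
    change (S (diagCLM b (lp.single 2 j ξ)) : ℕ → H) i = b ((S (lp.single 2 j ξ) : ℕ → H) i) at h1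
    rw [diagCLM_single] at h1
    exact h1.symm
  have h2 : (2 : ENNReal) ≠ ⊤ := by norm_num
  refine lp.ext_continuousLinearMap h2 fun j => ?_
  ext ξ i
  change (S (diagCLM a (lp.single 2 j ξ)) : ℕ → H) i = a ((S (lp.single 2 j ξ) : ℕ → H) i)
  rw [diagCLM_single]
  exact congr($(Set.mem_centralizer_iff.1 ha _ (hmem i j)) ξ)

end Amplification

/-! ### The trace representation of a finite von Neumann algebra -/

section Concrete

variable {H : Type*} [NormedAddCommGroup H] [InnerProductSpace ℂ H] [CompleteSpace H]

/-- A bounded sequence of operators that converges on a total set converges strongly. -/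
lemma exists_strong_limit {u : ℕ → H →L[ℂ] H} {C : ℝ} (hC : ∀ n, ‖u n‖ ≤ C) {D : Set H}
    (hD : (Submodule.span ℂ D).topologicalClosure = ⊤)
    (hconv : ∀ ξ ∈ D, CauchySeq fun n => u n ξ) :
    ∃ T : H →L[ℂ] H, ‖T‖ ≤ C ∧ ∀ ξ, Tendsto (fun n => u n ξ) atTop (𝓝 (T ξ)) := by
  have hC0 : 0 ≤ C := (norm_nonneg _).trans (hC 0)
  have hspan : ∀ ξ ∈ Submodule.span ℂ D, CauchySeq fun n => u n ξ := by
    intro ξ hξ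
    induction hξ using Submodule.span_induction with
    | mem ξ hξ => exact hconv ξ hξ
    | zero => simpa using cauchySeq_const (0 : H)
    | add ξ η _ _ hξ hη => simp only [map_add]; exact hξ.add hη
    | smul c ξ _ hξ =>
      simp only [map_smul]; exact (uniformContinuous_const_smul c).comp_cauchySeq hξ
  have hall : ∀ ξ, CauchySeq fun n => u n ξ := by
    intro ξ
    have hξ : ξ ∈ closure (Submodule.span ℂ D : Set H) := by
      rw [← Submodule.topologicalClosure_coe, hD]; trivial
    refine Metric.cauchySeq_iff'.2 fun ε hε => ?_
    obtain ⟨η, hη, hd⟩ := Metric.mem_closure_iff.1 hξ (ε / (4 * (C + 1))) (by positivity)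
    obtain ⟨N, hN⟩ := Metric.cauchySeq_iff'.1 (hspan η hη) (ε / 4) (by positivity)
    refine ⟨N, fun n hn => ?_⟩
    have hb : ∀ m, dist (u m ξ) (u m η) ≤ ε / 4 := by
      intro m
      rw [dist_eq_norm, ← map_sub]
      refine ((u m).le_of_opNorm_le (hC m) _).trans ?_
      rw [dist_eq_norm, lt_div_iff₀ (by positivity)] at hd
      nlinarith [norm_nonneg (ξ - η)]
    have h1 := hb n
    have h2 := hb N
    have h3 := hN n hn
    rw [dist_comm] at h2
    have := dist_triangle4 (u n ξ) (u n η) (u N η) (u N ξ)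
    linarith
  choose f hf using fun ξ => cauchySeq_tendsto_of_complete (hall ξ)
  refine ⟨continuousLinearMapOfTendsto u (tendsto_pi_nhds.2 hf), ?_, hf⟩
  refine ContinuousLinearMap.opNorm_le_bound _ hC0 fun ξ => ?_
  exact le_of_tendsto (hf ξ).norm (Eventually.of_forall fun n => (u n).le_of_opNorm_le (hC n) ξ)

variable {M : VonNeumannAlgebra H} {τ : M.toStarSubalgebra →ₗ[ℂ] ℂ}

/-- A sequence of vectors implementing a faithful functional is separating for `M`, hence cyclic
for the commutant of `M`. -/
lemma span_commutant_eq_top {ξ : ℕ → H}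
    (hsep : ∀ x ∈ M, (∀ m, x (ξ m) = 0) → x = 0) :
    (Submodule.span ℂ {η | ∃ y ∈ M.commutant, ∃ m, η = y (ξ m)}).topologicalClosure = ⊤ := by
  set V : Submodule ℂ H := Submodule.span ℂ {η | ∃ y ∈ M.commutant, ∃ m, η = y (ξ m)} with hV
  have : CompleteSpace V.topologicalClosure := V.isClosed_topologicalClosure.completeSpace_coe
  set p : H →L[ℂ] H := V.topologicalClosure.starProjection with hp
  have hpM : p ∈ M := by
    rw [VonNeumannAlgebra.IsStarProjection.mem_iff isStarProjection_starProjection]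
    intro y hy
    rw [Submodule.range_starProjection]
    refine (Module.End.mem_invtSubmodule _).2 ?_
    have h1 : V ≤ V.comap (y : H →ₗ[ℂ] H) := by
      refine Submodule.span_le.2 ?_
      rintro _ ⟨z, hz, m, rfl⟩
      exact Submodule.subset_span ⟨y * z, mul_mem hy hz, m, rfl⟩
    intro η hη
    exact map_mem_closure y.continuous hη fun ζ hζ => h1 hζ
  have hp1 : 1 - p = 0 := by
    refine hsep _ (sub_mem (one_mem M) hpM) fun m => ?_
    have hm : ξ m ∈ V.topologicalClosure :=
      V.le_topologicalClosure (Submodule.subset_span ⟨1, one_mem _, m, rfl⟩)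
    simp [hp, Submodule.starProjection_eq_self_iff.2 hm]
  rw [Submodule.eq_top_iff']
  intro η
  have : p = 1 := (sub_eq_zero.1 hp1).symm
  exact Submodule.starProjection_eq_self_iff.1 (congr($this η))

/-- The vector in the amplification implementing a faithful normal tracial state makes it a tracial
representation. -/
theorem IsFaithfulNormalTracialState.exists_isTracialRep
    (hτ : IsFaithfulNormalTracialState M τ) : ∃ Ω : lp (fun _ : ℕ => H) 2,
      IsTracialRep τ ((amplification H).comp M.toStarSubalgebra.subtype) Ω := by
  obtain ⟨ξ, hξ, hsum⟩ := hτ.normal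
  have hmem : Memℓp ξ 2 := by
    refine memℓp_gen ?_
    simpa using hξ
  set Ω : lp (fun _ : ℕ => H) 2 := ⟨ξ, hmem⟩ with hΩ
  have happ : ∀ x, τ x = inner ℂ Ω (amplification H (x : H →L[ℂ] H) Ω) := fun x =>
    (hsum x).unique (lp.hasSum_inner Ω _)
  have hsep' : ∀ x : M.toStarSubalgebra, amplification H (x : H →L[ℂ] H) Ω = 0 → x = 0 := by
    intro x hx
    refine hτ.faithful x ?_
    rw [happ, MulMemClass.coe_mul, map_mul, mul_apply_eq_comp, hx, map_zero, inner_zero_right]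
  have hsep : ∀ x ∈ M, (∀ m, x (ξ m) = 0) → x = 0 := by
    intro x hx h0
    refine congrArg Subtype.val (hsep' ⟨x, hx⟩ ?_)
    ext m
    exact h0 m
  have hcoe : ∀ {a : M.toStarSubalgebra}, star a = a → star (a : H →L[ℂ] H) = a := fun ha =>
    congrArg Subtype.val ha
  refine ⟨Ω, happ, hτ.map_one, hτ.tracial, hsep', ?_, ?_, ?_⟩
  · intro C u ζ hC hu
    have hC' : ∀ n, ‖(u n : H →L[ℂ] H)‖ ≤ C := fun n => by
      rw [← norm_amplification]; exact hC n
    have hcoord : ∀ m, Tendsto (fun n => (u n : H →L[ℂ] H) (ξ m)) atTop (𝓝 (ζ m)) := fun m =>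
      ((lp.evalCLM ℂ (fun _ : ℕ => H) 2 m).continuous.tendsto ζ).comp hu
    obtain ⟨T, hT, hlim⟩ := exists_strong_limit hC' (span_commutant_eq_top hsep) (by
      rintro _ ⟨y, hy, m, rfl⟩
      refine (((y.continuous.tendsto _).comp (hcoord m)).congr fun n => ?_).cauchySeq
      exact congr($(VonNeumannAlgebra.mem_commutant_iff.1 hy _ (u n).2) (ξ m)).symm)
    have hTM : T ∈ M := by
      rw [← M.commutant_commutant, VonNeumannAlgebra.mem_commutant_iff]
      intro y hy
      ext η
      refine tendsto_nhds_unique ((y.continuous.tendsto _).comp (hlim η))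
        ((hlim (y η)).congr fun n => ?_)
      exact congr($(VonNeumannAlgebra.mem_commutant_iff.1 hy _ (u n).2) η)
    refine ⟨⟨T, hTM⟩, (norm_amplification T).trans_le hT, ?_⟩
    ext m
    exact tendsto_nhds_unique (hlim (ξ m)) (hcoord m)
  · intro h hh
    obtain ⟨e, s, t, he, hee, hs, ht, hhe, hhe', hker, hcomm, -⟩ :=
      exists_sign (h : H →L[ℂ] H) (hcoe hh)
    have hM : e ∈ M ∧ s ∈ M ∧ t ∈ M := ⟨mem_of_forall_commute M h.2 fun y hy => (hcomm y hy).1,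
      mem_of_forall_commute M h.2 fun y hy => (hcomm y hy).2.1,
      mem_of_forall_commute M h.2 fun y hy => (hcomm y hy).2.2⟩
    refine ⟨⟨e, hM.1⟩, ⟨s, hM.2.1⟩, ⟨t, hM.2.2⟩, Subtype.ext he, Subtype.ext hee, Subtype.ext hs,
      Subtype.ext ht, Subtype.ext hhe, Subtype.ext hhe', fun y hy =>
      Subtype.ext (hker y (congrArg Subtype.val hy)), fun y hy => ?_⟩
    have := hcomm y (congrArg Subtype.val hy.eq)
    exact ⟨Subtype.ext this.1.eq, Subtype.ext this.2.1.eq, Subtype.ext this.2.2.eq⟩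
  · intro s δ hs hδ
    obtain ⟨k, hk, hkk, hcomm⟩ := exists_invSqrt (s : H →L[ℂ] H) δ (hcoe hs) hδ
    exact ⟨⟨k, mem_of_forall_commute M s.2 hcomm⟩, Subtype.ext hk, Subtype.ext hkk, fun y hy =>
      Subtype.ext (hcomm y (congrArg Subtype.val hy.eq)).eq⟩

end Concrete

/-! ### Masas of a von Neumann algebra -/

section Masa

variable {R : Type*} [Ring R] [StarRing R] [Algebra ℂ R] [StarModule ℂ R]
variable {A : StarSubalgebra ℂ R}

lemma IsMasa.mem_of_star_eq (hA : IsMasa A) {h : R} (hh : star h = h)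
    (hcomm : ∀ a ∈ A, Commute h a) : h ∈ A := by
  set B : StarSubalgebra ℂ R := StarAlgebra.adjoin ℂ (insert h (A : Set R)) with hB
  have hle : A ≤ B := fun a ha => StarAlgebra.subset_adjoin ℂ _ (Set.mem_insert_of_mem h ha)
  have hgen : ∀ a ∈ insert h (A : Set R), ∀ b ∈ insert h (A : Set R), Commute a b := by
    rintro a (rfl | ha) b (rfl | hb)
    · exact Commute.refl _
    · exact hcomm b hb
    · exact (hcomm a ha).symm
    · exact hA.prop a ha b hb
  have hstar : ∀ a ∈ insert h (A : Set R), star a ∈ insert h (A : Set R) := by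
    rintro a (rfl | ha)
    · rw [hh]; exact Set.mem_insert _ _
    · exact Set.mem_insert_of_mem _ (star_mem ha)
  have := StarAlgebra.isMulCommutative_adjoin ℂ (fun a ha b hb => (hgen a ha b hb).eq)
    fun a ha b hb => (hgen a ha _ (hstar b hb)).eq
  have hBcomm : ∀ x ∈ B, ∀ y ∈ B, x * y = y * x := fun _ hx _ hy => setLike_mul_comm hx hy
  exact hA.le_of_ge hBcomm hle (StarAlgebra.subset_adjoin ℂ _ (Set.mem_insert _ _))

omit [StarModule ℂ R] in
/-- Twice an element is a combination of the self-adjoint elements `z + z*` and `i (z - z*)`. -/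
lemma two_smul_eq_add_star (z : R) : (2 : ℂ) • z =
    (z + star z) - Complex.I • (Complex.I • (z - star z)) := by
  rw [smul_smul, Complex.I_mul_I]; module

omit [Algebra ℂ R] [StarModule ℂ R] in
lemma star_add_star (z : R) : star (z + star z) = z + star z := by
  rw [star_add, star_star, add_comm]

lemma star_I_smul_sub_star (z : R) :
    star (Complex.I • (z - star z)) = Complex.I • (z - star z) := by
  rw [star_smul, star_sub, star_star, Complex.star_def, Complex.conj_I]; module

lemma IsMasa.mem_of_commute (hA : IsMasa A) {z : R} (hcomm : ∀ a ∈ A, Commute z a) : z ∈ A := by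
  have hstar : ∀ a ∈ A, Commute (star z) a := fun a ha => by
    simpa using (hcomm (star a) (star_mem ha)).star_star
  have h1 : z + star z ∈ A := hA.mem_of_star_eq (star_add_star z) fun a ha =>
    (hcomm a ha).add_left (hstar a ha)
  have h2 : Complex.I • (z - star z) ∈ A := hA.mem_of_star_eq (star_I_smul_sub_star z) fun a ha =>
    ((hcomm a ha).sub_left (hstar a ha)).smul_left _
  have h3 : z = (2⁻¹ : ℂ) • ((2 : ℂ) • z) := by rw [smul_smul]; norm_num
  rw [h3, two_smul_eq_add_star]
  exact A.smul_mem (sub_mem h1 (A.smul_mem h2 _)) _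

end Masa

section VonNeumann

variable {H : Type*} [NormedAddCommGroup H] [InnerProductSpace ℂ H] [CompleteSpace H]
variable {M : VonNeumannAlgebra H} {τ : M.toStarSubalgebra →ₗ[ℂ] ℂ}
  {A : StarSubalgebra ℂ M.toStarSubalgebra} {v : unitary M.toStarSubalgebra}

lemma IsHaarUnitaryGenerator.mem_centralizer (hv : IsHaarUnitaryGenerator M τ A v)
    {a : M.toStarSubalgebra} (ha : a ∈ A) : (a : H →L[ℂ] H) ∈ Set.centralizer (Set.centralizer
      {((v : M.toStarSubalgebra) : H →L[ℂ] H), star ((v : M.toStarSubalgebra) : H →L[ℂ] H)}) := by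
  rw [← hv.generates]; exact ⟨a, ha, rfl⟩

theorem IsHaarUnitaryGenerator.isCyclicMasa (hv : IsHaarUnitaryGenerator M τ A v)
    (hA : IsMasa A) : IsCyclicMasa A v where
  mem := hv.mem
  comm := hA.prop
  masa z hz := by
    refine hA.mem_of_commute fun a ha => ?_
    have hz' : Commute (star (v : M.toStarSubalgebra)) z :=
      show Commute ((star v : unitary M.toStarSubalgebra) : M.toStarSubalgebra) z from by
        have h1 : star (v : M.toStarSubalgebra) * v = 1 := by simp
        have h2 : (v : M.toStarSubalgebra) * star (v : M.toStarSubalgebra) = 1 := by simp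
        change star (v : M.toStarSubalgebra) * z = z * star (v : M.toStarSubalgebra)
        calc star (v : M.toStarSubalgebra) * z
            = star (v : M.toStarSubalgebra) * (z * v) * star (v : M.toStarSubalgebra) := by
              rw [mul_assoc, mul_assoc, h2, mul_one]
          _ = z * star (v : M.toStarSubalgebra) := by
              rw [← hz.eq, ← mul_assoc, h1, one_mul]
    have hmem : (z : H →L[ℂ] H) ∈ Set.centralizer {((v : M.toStarSubalgebra) : H →L[ℂ] H),
        star ((v : M.toStarSubalgebra) : H →L[ℂ] H)} := by
      rintro _ (rfl | rfl)
      · exact congrArg Subtype.val hz.eq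
      · exact congrArg Subtype.val hz'.eq
    exact Subtype.ext (hv.mem_centralizer ha _ hmem)

/-- A self-adjoint element `h` of a masa is determined by countably many projections of the masa:
subtracting suitable multiples of the symmetries `2e - 1` halves its norm in each step. -/
lemma IsCyclicMasa.exists_seq_projection (hA : IsCyclicMasa A v) {h : M.toStarSubalgebra}
    (hh : star h = h) (hhA : h ∈ A) : ∃ e : ℕ → M.toStarSubalgebra,
      (∀ n, e n ∈ A ∧ star (e n) = e n ∧ e n * e n = e n) ∧
      ∀ z, (∀ n, Commute (e n) z) → Commute h z := by
  have hstep : ∀ g : M.toStarSubalgebra, ∃ e : M.toStarSubalgebra, star g = g → g ∈ A →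
      (e ∈ A ∧ star e = e ∧ e * e = e) ∧ ∀ C : ℝ, ‖(g : H →L[ℂ] H)‖ ≤ C →
        ‖((g - ((C / 2 : ℝ) : ℂ) • (e + e - 1) : M.toStarSubalgebra) : H →L[ℂ] H)‖ ≤ C / 2 := by
    intro g
    by_cases hg : star g = g ∧ g ∈ A
    · obtain ⟨e, s, t, he, hee, -, -, -, -, -, hcomm, hnorm⟩ :=
        exists_sign (g : H →L[ℂ] H) (congrArg Subtype.val hg.1)
      have heM : e ∈ M := mem_of_forall_commute M g.2 fun y hy => (hcomm y hy).1
      refine ⟨⟨e, heM⟩, fun _ _ => ⟨⟨hA.masa _ ?_, Subtype.ext he, Subtype.ext hee⟩, hnorm⟩⟩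
      exact Subtype.ext (hcomm _ (congrArg Subtype.val (hA.comm g hg.2 _ hA.mem).eq)).1.eq.symm
    · exact ⟨0, fun h1 h2 => absurd ⟨h1, h2⟩ hg⟩
  choose E hE using hstep
  set C : ℝ := ‖(h : H →L[ℂ] H)‖ with hC
  let c : ℕ → ℝ := fun n => C / 2 ^ n
  obtain ⟨g, hg0, hgs⟩ : ∃ g : ℕ → M.toStarSubalgebra, g 0 = h ∧
      ∀ n, g (n + 1) = g n - ((c n / 2 : ℝ) : ℂ) • (E (g n) + E (g n) - 1) :=
    ⟨fun n => Nat.rec h (fun n g => g - ((c n / 2 : ℝ) : ℂ) • (E g + E g - 1)) n, rfl, fun _ => rfl⟩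
  have hinv : ∀ n, star (g n) = g n ∧ g n ∈ A ∧ ‖(g n : H →L[ℂ] H)‖ ≤ c n := by
    intro n
    induction n with
    | zero => rw [hg0]; exact ⟨hh, hhA, by simp [c, hC]⟩
    | succ n ih =>
      obtain ⟨h1, h2, h3⟩ := ih
      obtain ⟨⟨h4, h5, -⟩, h6⟩ := hE (g n) h1 h2
      refine ⟨?_, ?_, ?_⟩
      · rw [hgs, star_sub, star_smul, star_sub, star_add, star_one, h1, h5, Complex.star_def,
          Complex.conj_ofReal]
      · rw [hgs]
        exact sub_mem h2 (A.smul_mem (sub_mem (add_mem h4 h4) (one_mem A)) _)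
      · have h7 := h6 (c n) h3
        rw [hgs]
        refine h7.trans_eq ?_
        simp only [c, pow_succ]; field_simp
  refine ⟨fun n => E (g n), fun n => (hE _ (hinv n).1 (hinv n).2.1).1, fun z hz => ?_⟩
  have hcomm : ∀ n, g n * z - z * g n = h * z - z * h := by
    intro n
    induction n with
    | zero => rw [hg0]
    | succ n ih =>
      have h1 : Commute (((c n / 2 : ℝ) : ℂ) • (E (g n) + E (g n) - 1)) z :=
        ((((hz n).add_left (hz n)).sub_left (Commute.one_left z))).smul_left _
      rw [← ih, hgs, sub_mul, mul_sub, h1.eq]; abel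
  have hlim : Tendsto (fun n => 2 * ‖(z : H →L[ℂ] H)‖ * c n) atTop (𝓝 0) := by
    have h1 : Tendsto c atTop (𝓝 0) := tendsto_const_nhds.div_atTop
      (tendsto_pow_atTop_atTop_of_one_lt one_lt_two)
    simpa using h1.const_mul (2 * ‖(z : H →L[ℂ] H)‖)
  have hle : ∀ n, ‖((h * z - z * h : M.toStarSubalgebra) : H →L[ℂ] H)‖ ≤
      2 * ‖(z : H →L[ℂ] H)‖ * c n := by
    intro n
    rw [← hcomm n]
    change ‖(g n : H →L[ℂ] H) * z - z * g n‖ ≤ _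
    have h1 := norm_mul_le (g n : H →L[ℂ] H) z
    have h2 := norm_mul_le (z : H →L[ℂ] H) (g n)
    have h3 := norm_sub_le ((g n : H →L[ℂ] H) * z) (z * g n)
    have h4 := mul_le_mul_of_nonneg_left (hinv n).2.2 (norm_nonneg (z : H →L[ℂ] H))
    linarith [mul_comm ‖(g n : H →L[ℂ] H)‖ ‖(z : H →L[ℂ] H)‖]
  have h0 : ((h * z - z * h : M.toStarSubalgebra) : H →L[ℂ] H) = 0 :=
    norm_le_zero_iff.1 (ge_of_tendsto' hlim hle)
  exact sub_eq_zero.1 (Subtype.ext h0)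

/-- A cyclic masa is the commutant of countably many of its projections. -/
lemma IsCyclicMasa.exists_seq_projection_generating (hA : IsCyclicMasa A v) :
    ∃ e : ℕ → M.toStarSubalgebra, (∀ n, e n ∈ A ∧ star (e n) = e n ∧ e n * e n = e n) ∧
      ∀ z, (∀ n, Commute (e n) z) → z ∈ A := by
  obtain ⟨e, he, he'⟩ := hA.exists_seq_projection (star_add_star (v : M.toStarSubalgebra))
    (add_mem hA.mem (star_mem hA.mem))
  obtain ⟨f, hf, hf'⟩ := hA.exists_seq_projection
    (star_I_smul_sub_star (v : M.toStarSubalgebra))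
    (A.smul_mem (sub_mem hA.mem (star_mem hA.mem)) _)
  refine ⟨fun n => if Even n then e (n / 2) else f (n / 2), fun n => ?_, fun z hz => ?_⟩
  · dsimp only
    split_ifs
    exacts [he _, hf _]
  · have h1 := he' z fun n => by simpa using hz (2 * n)
    have h2 := hf' z fun n => by
      have : Commute (if Even (2 * n + 1) then e ((2 * n + 1) / 2) else f ((2 * n + 1) / 2)) z :=
        hz (2 * n + 1)
      rwa [if_neg (by simp), show (2 * n + 1) / 2 = n by omega] at this
    refine hA.masa z ?_
    have h3 : (v : M.toStarSubalgebra) = (2⁻¹ : ℂ) • ((2 : ℂ) • (v : M.toStarSubalgebra)) := by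
      rw [smul_smul]; norm_num
    rw [h3, two_smul_eq_add_star]
    exact (h1.sub_left (h2.smul_left _)).smul_left _

end VonNeumann

end MasaWAHP

open MasaWAHP in
theorem mainTheorem6 {H : Type*} [NormedAddCommGroup H] [InnerProductSpace ℂ H] [CompleteSpace H]
    [TopologicalSpace.SeparableSpace H]
    (M : VonNeumannAlgebra H) (hM : IsTypeIIOneFactor M)
    (τ : M.toStarSubalgebra →ₗ[ℂ] ℂ) (hτ : IsFaithfulNormalTracialState M τ)
    (A : StarSubalgebra ℂ M.toStarSubalgebra) (hA : IsMasa A) (hsing : IsSingular A)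
    (v : unitary M.toStarSubalgebra) (hv : IsHaarUnitaryGenerator M τ A v) :
    (∀ (n : ℕ) (x : Fin n → M.toStarSubalgebra), (∀ i, condExp τ A (x i) = 0) →
      Filter.Tendsto (fun N : ℕ => (1 / (2 * (N : ℝ) + 1)) *
          ∑ k ∈ Finset.Icc (-(N : ℤ)) (N : ℤ), ∑ i : Fin n,
            twoNorm τ (condExp τ A
              (x i * ((v ^ k : unitary M.toStarSubalgebra) : M.toStarSubalgebra) *
                star (x i))) ^ 2)
        Filter.atTop (nhds 0)) ∧
    (∀ (ε : ℝ), 0 < ε → ∀ (n : ℕ) (x : Fin n → M.toStarSubalgebra) (K : ℕ), ∃ k : ℕ, K ≤ k ∧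
      ∀ i j : Fin n,
        twoNorm τ (condExp τ A (x i * (v : M.toStarSubalgebra) ^ k * star (x j)) -
          condExp τ A (x i) * (v : M.toStarSubalgebra) ^ k * condExp τ A (star (x j))) < ε) := by
  obtain ⟨Ω, h⟩ := hτ.exists_isTracialRep
  have hA' := hv.isCyclicMasa hA
  have havg := h.tendsto_average hA' hsing (fun S hS hS' a ha =>
    commute_amplification_of_mem_centralizer (hv.mem_centralizer ha) (by
      rintro _ (rfl | rfl)
      exacts [hS, hS'])) hA'.exists_seq_projection_generating
  simp only [h.twoNorm_eq]
  exact ⟨fun n x hx => tendsto_average_sum _ _ fun i _ => havg _ (hx i),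
    fun ε hε n x K => h.exists_pow_lt hA' havg hε n x K⟩
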